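/- Let $m,N\ge 1$ be integers, let $\mathbb{M}^{m\times N}$ be the space of real $m\times N$ matrices, and let $|\cdot|$ denote Lebesgue measure in $\mathbb{R}^N$. Let $f:\mathbb{R}^N\times\mathbb{M}^{m\times N}\to[0,+\infty]$ be a normal integrand, i.e. $f$ is measurable and $f(x,\cdot)$ is lower semicontinuous for every $x\in\mathbb{R}^N$; the value $+\infty$ is allowed. For a bounded open set $D\subset\mathbb{R}^N$ let $W^{1,\infty}_0(D;\mathbb{R}^m)$ be the set of all $\varphi\in W^{1,\infty}(D;\mathbb{R}^m)$ that (in their continuous representative) extend continuously to $\overline D$ with $\varphi=0$ on $\partial D$. With $Y:=\,]0,1[^N$, put $$\mathcal{Z}f(x,\xi):=\inf\Big\{\int_Y f(x,\xi+\nabla\varphi(y))\,dy:\varphi\in W^{1,\infty}_0(Y;\mathbb{R}^m)\Big\}.$$ A Borel measurable function $g:\mathbb{M}^{m\times N}\to[0,+\infty]$ is called quasiconvex if $$g(\xi)\le\frac1{|D|}\int_D g(\xi+\nabla\varphi(y))\,dy$$ for every $\xi\in\mathbb{M}^{m\times N}$, every non-empty bounded open set $D\subset\mathbb{R}^N$ with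 $|\partial D|=0$ and every $\varphi\in W^{1,\infty}_0(D;\mathbb{R}^m)$. The quasiconvex envelope $\mathcal{Q}f(x,\cdot)$ of $f(x,\cdot)$ is the greatest quasiconvex function that is less than or equal to $f(x,\cdot)$. Theorem. If $\mathcal{Z}f(x,\xi)<+\infty$ for all $(x,\xi)\in\mathbb{R}^N\times\mathbb{M}^{m\times N}$, then for every $x\in\mathbb{R}^N$ the quasiconvex envelope $\mathcal{Q}f(x,\cdot)$ exists, and $\mathcal{Q}f=\mathcal{Z}f$. In particular, $\mathcal{Z}f(x,\cdot)$ is quasiconvex for every $x\in\mathbb{R}^N$. -/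

import Mathlib

open MeasureTheory Set
open scoped ENNReal

/-- `ℝᴺ` with its Euclidean structure. -/
abbrev RVec (N : ℕ) : Type := EuclideanSpace ℝ (Fin N)

/-- The space `𝕄^{m×N}` of real `m × N` matrices. -/
abbrev RMat (m N : ℕ) : Type := Matrix (Fin m) (Fin N) ℝ

/-- `𝕄^{m×N}` carries the product (equivalently, Borel) `σ`-algebra. -/
instance instMeasurableSpaceRMat (m N : ℕ) : MeasurableSpace (RMat m N) :=
  inferInstanceAs (MeasurableSpace (Fin m → Fin N → ℝ))

instance instBorelSpaceRMat (m N : ℕ) : BorelSpace (RMat m N) :=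
  inferInstanceAs (BorelSpace (Fin m → Fin N → ℝ))

/-- The open unit cube `Y = ]0,1[ᴺ`. -/
def unitCube (N : ℕ) : Set (RVec N) := {y | ∀ i, y i ∈ Ioo (0 : ℝ) 1}

/-- `f : ℝᴺ × 𝕄^{m×N} → [0,+∞]` is a normal integrand: every `f(x,·)` is lower semicontinuous, and
`f` is measurable (Lebesgue measurability in `x`, Borel measurability in `ξ`; in particular every
Borel measurable `f` qualifies). -/
structure IsNormalIntegrand {m N : ℕ} (f : RVec N → RMat m N → ℝ≥0∞) : Prop where
  lsc : ∀ x, LowerSemicontinuous (f x)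
  meas : Measurable
    (fun p : NullMeasurableSpace (RVec N) (volume : Measure (RVec N)) × RMat m N => f p.1 p.2)

/-- `G` is a weak (distributional) gradient of `φ` in the open set `D`:
`∫_D φᵢ ∂ⱼψ = - ∫_D Gᵢⱼ ψ` for every test function `ψ ∈ C_c^∞(D)`. -/
def IsWeakGradient {m N : ℕ} (D : Set (RVec N)) (φ : RVec N → RVec m) (G : RVec N → RMat m N) :
    Prop :=
  ∀ (i : Fin m) (j : Fin N) (ψ : RVec N → ℝ), ContDiff ℝ (⊤ : ℕ∞) ψ → HasCompactSupport ψ →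
    tsupport ψ ⊆ D →
    ∫ y in D, φ y i * fderiv ℝ ψ y (EuclideanSpace.single j 1) = - ∫ y in D, G y i j * ψ y

/-- `φ ∈ W^{1,∞}(D; ℝᵐ)` and `∇φ = G` almost everywhere in `D`. -/
structure IsW1Inf {m N : ℕ} (D : Set (RVec N)) (φ : RVec N → RVec m) (G : RVec N → RMat m N) :
    Prop where
  memLp : MemLp φ ∞ (volume.restrict D)
  memLp_grad : ∀ i j, MemLp (fun y => G y i j) ∞ (volume.restrict D)
  weakGradient : IsWeakGradient D φ G

/-- `φ ∈ W^{1,∞}₀(D; ℝᵐ)` and `∇φ = G` almost everywhere in `D`, where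
`W^{1,∞}₀(D; ℝᵐ) = {φ ∈ W^{1,∞}(D; ℝᵐ) : φ = 0 on ∂D}`. Elements of `W^{1,∞}` have a continuous
representative in `D`, and it is the one that is used: `φ` is continuous up to the boundary and
vanishes there. The values of `φ` and `G` outside the closure of `D` are irrelevant. -/
structure IsW1InfZero {m N : ℕ} (D : Set (RVec N)) (φ : RVec N → RVec m)
    (G : RVec N → RMat m N) : Prop extends IsW1Inf D φ G where
  continuousOn : ContinuousOn φ (closure D)
  boundary : ∀ y ∈ frontier D, φ y = 0

/-- `𝒵f(x,ξ) = inf {∫_Y f(x, ξ + ∇φ(y)) dy : φ ∈ W^{1,∞}₀(Y; ℝᵐ)}`. -/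
noncomputable def ZEnvelope {m N : ℕ} (f : RVec N → RMat m N → ℝ≥0∞) (x : RVec N)
    (ξ : RMat m N) : ℝ≥0∞ :=
  ⨅ (φ : RVec N → RVec m) (G : RVec N → RMat m N) (_ : IsW1InfZero (unitCube N) φ G),
    ∫⁻ y in unitCube N, f x (ξ + G y)

/-- Quasiconvexity in the sense of Morrey of a (Borel measurable) function
`g : 𝕄^{m×N} → [0,+∞]`. -/
structure IsQuasiconvex {m N : ℕ} (g : RMat m N → ℝ≥0∞) : Prop where
  measurable : Measurable g
  le_average : ∀ (ξ : RMat m N) (D : Set (RVec N)), IsOpen D → D.Nonempty →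
    Bornology.IsBounded D → volume (frontier D) = 0 →
    ∀ (φ : RVec N → RVec m) (G : RVec N → RMat m N), IsW1InfZero D φ G →
      g ξ ≤ (volume D)⁻¹ * ∫⁻ y in D, g (ξ + G y)

/-- The quasiconvex functions that are less than or equal to `h`. -/
def quasiconvexMinorants {m N : ℕ} (h : RMat m N → ℝ≥0∞) : Set (RMat m N → ℝ≥0∞) :=
  {g | IsQuasiconvex g ∧ g ≤ h}

/-- The quasiconvex envelope `𝒬f(x,·)`, as the supremum of the quasiconvex functions that are less
than or equal to `f(x,·)`. -/
noncomputable def quasiconvexEnvelope {m N : ℕ} (f : RVec N → RMat m N → ℝ≥0∞) (x : RVec N) :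
    RMat m N → ℝ≥0∞ :=
  sSup (quasiconvexMinorants (f x))

/-- If there is a greatest quasiconvex function below `f(x,·)`, then it is `𝒬f(x,·)`. -/
theorem quasiconvexEnvelope_eq_of_isGreatest {m N : ℕ} {f : RVec N → RMat m N → ℝ≥0∞}
    {x : RVec N} {q : RMat m N → ℝ≥0∞} (hq : IsGreatest (quasiconvexMinorants (f x)) q) :
    quasiconvexEnvelope f x = q :=
  hq.csSup_eq

/-! Fix `x` and put `g = 𝒵f(x,·)`. Testing with `φ = 0` gives `g ≤ f(x,·)`, and a quasiconvex
minorant of `f(x,·)` lies below `g` by its own inequality on `D = Y`. Everything therefore rests on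
the quasiconvexity of `g`.

Elements of `W^{1,∞}₀(D)`, extended by zero, are globally Lipschitz for every open `D`, however
irregular its boundary (`IsW1InfZero.exists_lipschitzWith`). So one may work with Lipschitz maps on
the whole space and their a.e. classical gradients.

If `u` is piecewise affine with finitely many gradients, a Vitali covering fills the cube with small
cubes on which `u` is affine. Adding to `u`, on each of them, a rescaled almost optimal competitor
for `g(ξ + ∇u)` produces a competitor for `g(ξ)`, whence the inequality
(`ZEnvelope_le_lintegral_of_piecewise_affine`).

Reaching all Lipschitz maps requires continuity of `g`, which `f` cannot supply because it may take
the value `+∞`. It follows from finiteness of `g`: the pyramids `max(min_b (1 + ⟨b,y⟩), 0) eᵢ` yield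
Jensen-type inequalities in the rows of `ξ`, with weights dictated by the pyramid
(`exists_weights`). Pyramids whose slopes point to the vertices of a cube give local boundedness
(`exists_bound`); adding one small slope gives a local Lipschitz estimate (`le_add_single`,
`exists_lipschitz_bound`).

Finally a Lipschitz `φ` is interpolated on the simplices of the Kuhn triangulation of `hℤᴺ`. The
interpolants are uniformly Lipschitz and their gradients converge to `∇φ` wherever `φ` is
differentiable, off a null set, so dominated convergence finishes (`volume_mul_le`). The
interpolation is written as the average over `s ∈ [0,1)` of the samples at `⌊y + s(1,…,1)⌋`, which
avoids any explicit triangulation. -/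

variable {m N : ℕ}

/-! ### Lipschitz maps, their Jacobians and integration by parts -/

/-- The Jacobian matrix of `u` at `y`. -/
noncomputable def jac {m N : ℕ} (u : RVec N → RVec m) (y : RVec N) : RMat m N :=
  Matrix.of fun i j => fderiv ℝ u y (EuclideanSpace.single j 1) i


theorem jac_eq_zero_of_eventuallyEq_const {u : RVec N → RVec m} {y : RVec N} {c : RVec m}
    (h : ∀ᶠ z in nhds y, u z = c) : jac u y = 0 := by
  have h' : u =ᶠ[nhds y] fun _ => c := h
  ext i j
  simp [jac, h'.fderiv_eq]

theorem measurable_jac (u : RVec N → RVec m) : Measurable (jac u) := by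
  refine measurable_pi_lambda _ fun i => measurable_pi_lambda _ fun j => ?_
  have h1 : Measurable fun y => fderiv ℝ u y (EuclideanSpace.single j 1) :=
    measurable_fderiv_apply_const ℝ u _
  exact ((EuclideanSpace.proj (𝕜 := ℝ) i).continuous.measurable).comp h1

theorem abs_jac_le {u : RVec N → RVec m} {L : NNReal} (hu : LipschitzWith L u) (y : RVec N)
    (i : Fin m) (j : Fin N) : |jac u y i j| ≤ L := by
  have h1 : |jac u y i j| ≤ ‖fderiv ℝ u y (EuclideanSpace.single j 1)‖ :=
    PiLp.norm_apply_le (fderiv ℝ u y (EuclideanSpace.single j 1)) i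
  refine h1.trans ((ContinuousLinearMap.le_opNorm _ _).trans ?_)
  simpa using norm_fderiv_le_of_lipschitz ℝ hu

theorem lineDeriv_component_eq_jac {u : RVec N → RVec m} {y : RVec N}
    (h : DifferentiableAt ℝ u y) (i : Fin m) (j : Fin N) :
    lineDeriv ℝ (fun z => u z i) y (EuclideanSpace.single j 1) = jac u y i j := by
  have h1 : HasFDerivAt (fun z => u z i)
      ((EuclideanSpace.proj (𝕜 := ℝ) i).comp (fderiv ℝ u y)) y :=
    (EuclideanSpace.proj (𝕜 := ℝ) i).hasFDerivAt.comp y h.hasFDerivAt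
  rw [(h1.hasLineDerivAt _).lineDeriv]
  rfl

theorem LipschitzWith.component {u : RVec N → RVec m} {L : NNReal} (hu : LipschitzWith L u)
    (i : Fin m) : LipschitzWith L fun z => u z i := by
  refine LipschitzWith.of_dist_le_mul fun x y => ?_
  refine le_trans ?_ (hu.dist_le_mul x y)
  rw [dist_eq_norm, dist_eq_norm]
  exact PiLp.norm_apply_le (u x - u y) i

/-- Integration by parts for a Lipschitz map against a test function. -/
theorem integral_component_mul_fderiv {u : RVec N → RVec m} {L : NNReal} (hu : LipschitzWith L u)
    {ψ : RVec N → ℝ} (hψ : ContDiff ℝ (⊤ : ℕ∞) ψ) (hc : HasCompactSupport ψ) (i : Fin m)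
    (j : Fin N) :
    ∫ y, u y i * fderiv ℝ ψ y (EuclideanSpace.single j 1) = - ∫ y, jac u y i j * ψ y := by
  have hψ1 : ContDiff ℝ 1 ψ := hψ.of_le (by exact_mod_cast le_top)
  obtain ⟨C, hC⟩ := hψ1.lipschitzWith_of_hasCompactSupport hc one_ne_zero
  have key := LipschitzWith.integral_lineDeriv_mul_eq (μ := (volume : Measure (RVec N)))
    (hu.component i) hC hc (EuclideanSpace.single j 1)
  have e1 : ∫ y, jac u y i j * ψ y =
      ∫ y, lineDeriv ℝ (fun z => u z i) y (EuclideanSpace.single j 1) * ψ y := by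
    refine integral_congr_ae ?_
    filter_upwards [hu.ae_differentiableAt (μ := volume)] with y hy
    rw [lineDeriv_component_eq_jac hy]
  rw [e1, key, ← integral_neg]
  refine integral_congr_ae (Filter.Eventually.of_forall fun y => ?_)
  simp only
  rw [((hψ1.differentiable one_ne_zero) y).lineDeriv_eq_fderiv]
  simp only [map_neg]
  ring

/-- The integral of the gradient of a compactly supported Lipschitz function vanishes. -/
theorem integral_jac_eq_zero {u : RVec N → RVec m} {L : NNReal} (hu : LipschitzWith L u)
    (hc : HasCompactSupport u) (i : Fin m) (j : Fin N) : ∫ y, jac u y i j = 0 := by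
  have hc' : HasCompactSupport fun z => u z i :=
    hc.comp_left (g := fun v : RVec m => v i) rfl
  have key := LipschitzWith.integral_lineDeriv_mul_eq (μ := (volume : Measure (RVec N)))
    (LipschitzWith.const (1 : ℝ)) (hu.component i) hc' (-EuclideanSpace.single j 1)
  simp only [neg_neg, mul_one] at key
  have e1 : ∫ y, jac u y i j =
      ∫ y, lineDeriv ℝ (fun z => u z i) y (EuclideanSpace.single j 1) := by
    refine integral_congr_ae ?_
    filter_upwards [hu.ae_differentiableAt (μ := volume)] with y hy
    rw [lineDeriv_component_eq_jac hy]
  rw [e1, ← key]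
  simp [lineDeriv]

/-- This makes Lipschitz maps admissible competitors in the definition of `ZEnvelope`; the converse
is `IsW1InfZero.exists_lipschitzWith`. -/
theorem LipschitzWith.isW1InfZero {D : Set (RVec N)} (hD : IsOpen D)
    (hDb : Bornology.IsBounded D) {u : RVec N → RVec m} {L : NNReal} (hu : LipschitzWith L u)
    (h0 : ∀ y ∉ D, u y = 0) : IsW1InfZero D u (jac u) where
  memLp := by
    obtain ⟨C, hC⟩ := (hDb.isCompact_closure.image hu.continuous).isBounded.exists_norm_le
    refine memLp_top_of_bound hu.continuous.aestronglyMeasurable C ?_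
    refine (ae_restrict_iff' hD.measurableSet).2 (Filter.Eventually.of_forall fun y hy => ?_)
    exact hC _ ⟨y, subset_closure hy, rfl⟩
  memLp_grad i j := by
    refine memLp_top_of_bound
      (((measurable_pi_iff.1 ((measurable_pi_iff.1 (measurable_jac u)) i) j)).aestronglyMeasurable)
      L (Filter.Eventually.of_forall fun y => ?_)
    exact abs_jac_le hu y i j
  weakGradient i j ψ hψ hc hs := by
    have a1 : ∫ y in D, u y i * fderiv ℝ ψ y (EuclideanSpace.single j 1) =
        ∫ y, u y i * fderiv ℝ ψ y (EuclideanSpace.single j 1) := by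
      refine setIntegral_eq_integral_of_forall_compl_eq_zero fun y hy => ?_
      simp [h0 y hy]
    have a2 : ∫ y in D, jac u y i j * ψ y = ∫ y, jac u y i j * ψ y := by
      refine setIntegral_eq_integral_of_forall_compl_eq_zero fun y hy => ?_
      rw [image_eq_zero_of_notMem_tsupport fun h => hy (hs h), mul_zero]
    rw [a1, a2]
    exact integral_component_mul_fderiv hu hψ hc i j
  continuousOn := hu.continuous.continuousOn
  boundary y hy := h0 y (by rw [hD.frontier_eq] at hy; exact hy.2)

/-! ### Lipschitz representatives of `W^{1,∞}₀` maps -/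

theorem EuclideanSpace.sum_smul_single {N : ℕ} (v : RVec N) :
    ∑ j, v j • EuclideanSpace.single j (1 : ℝ) = v := by
  ext i
  simp [Finset.sum_apply, Pi.single_apply]

theorem ContinuousLinearMap.norm_le_of_apply_single {F : Type*} [NormedAddCommGroup F]
    [NormedSpace ℝ F] (T : RVec N →L[ℝ] F) {K : ℝ} (hK0 : 0 ≤ K)
    (hK : ∀ j, ‖T (EuclideanSpace.single j 1)‖ ≤ K) : ‖T‖ ≤ N * K := by
  refine T.opNorm_le_bound (by positivity) fun v => ?_
  conv_lhs => rw [← EuclideanSpace.sum_smul_single v, map_sum]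
  calc ‖∑ j, T (v j • EuclideanSpace.single j (1 : ℝ))‖
      ≤ ∑ j, ‖T (v j • EuclideanSpace.single j (1 : ℝ))‖ := norm_sum_le _ _
    _ ≤ ∑ _j : Fin N, ‖v‖ * K := by
        refine Finset.sum_le_sum fun j _ => ?_
        rw [map_smul, norm_smul]
        exact mul_le_mul (PiLp.norm_apply_le v j) (hK j) (norm_nonneg _) (norm_nonneg _)
    _ = N * K * ‖v‖ := by simp; ring

/-- The gradient of a mollification, at a distance from the boundary, is bounded by the bound on
the weak gradient. -/
theorem norm_fderiv_mollification_le {D : Set (RVec N)}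
    {v : RVec N → ℝ} (hv : Continuous v) {H : Fin N → RVec N → ℝ} {K : ℝ} (hK0 : 0 ≤ K)
    (hK : ∀ j, ∀ᵐ y ∂volume.restrict D, |H j y| ≤ K)
    (hw : ∀ (j : Fin N) (ψ : RVec N → ℝ), ContDiff ℝ (⊤ : ℕ∞) ψ → HasCompactSupport ψ →
      tsupport ψ ⊆ D → ∫ y in D, v y * fderiv ℝ ψ y (EuclideanSpace.single j 1)
        = - ∫ y in D, H j y * ψ y)
    (b : ContDiffBump (0 : RVec N)) {x : RVec N} (hx : Metric.closedBall x b.rOut ⊆ D) :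
    ∃ T : RVec N →L[ℝ] ℝ,
      HasFDerivAt (fun z => ∫ t, v t * b.normed volume (z - t)) T x ∧ ‖T‖ ≤ N * K := by
  have hb : ContDiff ℝ (⊤ : ℕ∞) (b.normed (volume : Measure (RVec N))) := b.contDiff_normed
  have hb1 : ContDiff ℝ 1 (b.normed (volume : Measure (RVec N))) := b.contDiff_normed (n := 1)
  have hcb : HasCompactSupport (b.normed (volume : Measure (RVec N))) := b.hasCompactSupport_normed
  have hd := hcb.hasFDerivAt_convolution_right (μ := volume) (ContinuousLinearMap.mul ℝ ℝ)
    hv.locallyIntegrable hb1 x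
  refine ⟨_, hd, ContinuousLinearMap.norm_le_of_apply_single _ hK0 fun j => ?_⟩
  rw [convolution_precompR_apply _ hv.locallyIntegrable (hcb.fderiv (𝕜 := ℝ))
    (hb1.continuous_fderiv one_ne_zero)]
  rw [convolution_def]
  simp only [ContinuousLinearMap.mul_apply']
  set ψ : RVec N → ℝ := fun t => b.normed volume (x - t) with hψ
  have hψd : ∀ t, fderiv ℝ ψ t (EuclideanSpace.single j 1) =
      - fderiv ℝ (b.normed (volume : Measure (RVec N))) (x - t) (EuclideanSpace.single j 1) := by
    intro t
    have h1 : HasFDerivAt (fun t => x - t) (-ContinuousLinearMap.id ℝ (RVec N)) t :=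
      (hasFDerivAt_id t).const_sub x
    have h2 := ((hb1.differentiable one_ne_zero) (x - t)).hasFDerivAt.comp t h1
    have h3 : HasFDerivAt ψ _ t := h2
    rw [h3.fderiv]
    simp
  have hsupp : Function.support ψ ⊆ Metric.ball x b.rOut := by
    intro t ht
    have : x - t ∈ Function.support (b.normed (volume : Measure (RVec N))) := ht
    rw [b.support_normed_eq] at this
    rw [Metric.mem_ball, dist_comm, dist_eq_norm]
    simpa using this
  have htsupp : tsupport ψ ⊆ Metric.closedBall x b.rOut :=
    closure_minimal (hsupp.trans Metric.ball_subset_closedBall) Metric.isClosed_closedBall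
  have hψs : ContDiff ℝ (⊤ : ℕ∞) ψ := hb.comp (contDiff_const.sub contDiff_id)
  have hψc : HasCompactSupport ψ :=
    (isCompact_closedBall x b.rOut).of_isClosed_subset (isClosed_tsupport _) htsupp
  have hψD : tsupport ψ ⊆ D := htsupp.trans hx
  have hψ0 : ∀ t, 0 ≤ ψ t := fun t => b.nonneg_normed _
  have hψ1 : ∫ t, ψ t = 1 := by
    rw [hψ, integral_sub_left_eq_self (fun t => b.normed volume t)]
    exact b.integral_normed
  have hψi : Integrable ψ := hψs.continuous.integrable_of_hasCompactSupport hψc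
  -- The derivative in `x` of the kernel is minus its derivative in `t`; since `ψ` is a test
  -- function in `D`, the weak gradient takes over. The bound `K` then follows from `ψ ≥ 0` and `∫ ψ
  -- = 1`.
  have e1 : ∫ t, v t * fderiv ℝ (b.normed (volume : Measure (RVec N))) (x - t)
      (EuclideanSpace.single j 1) = ∫ y in D, H j y * ψ y := by
    have e2 := hw j ψ hψs hψc hψD
    rw [setIntegral_eq_integral_of_forall_compl_eq_zero] at e2
    · simp only [hψd, mul_neg, integral_neg, neg_inj] at e2
      exact e2
    · intro t ht
      have : fderiv ℝ ψ t = 0 := by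
        refine image_eq_zero_of_notMem_tsupport fun h => ht (hψD ?_)
        exact tsupport_fderiv_subset ℝ h
      simp [this]
  rw [e1]
  calc ‖∫ y in D, H j y * ψ y‖ ≤ ∫ y in D, K * ψ y := by
        refine norm_integral_le_of_norm_le (hψi.integrableOn.const_mul K) ?_
        filter_upwards [hK j] with y hy
        rw [norm_mul, Real.norm_eq_abs, Real.norm_eq_abs, abs_of_nonneg (hψ0 y)]
        exact mul_le_mul_of_nonneg_right hy (hψ0 y)
    _ = K * ∫ y in D, ψ y := integral_const_mul _ _
    _ ≤ K * ∫ y, ψ y := mul_le_mul_of_nonneg_left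
        (setIntegral_le_integral hψi (Filter.Eventually.of_forall hψ0)) hK0
    _ = K := by rw [hψ1, mul_one]

/-- Mollify at radii smaller than the distance from the segment to the complement of `D`, apply the
mean value inequality along the segment, and let the radius tend to zero; the gradient bound `N * K`
does not depend on the radius. -/
theorem abs_sub_le_of_segment_subset {D : Set (RVec N)} (hD : IsOpen D)
    {v : RVec N → ℝ} (hv : Continuous v) {H : Fin N → RVec N → ℝ} {K : ℝ} (hK0 : 0 ≤ K)
    (hK : ∀ j, ∀ᵐ y ∂volume.restrict D, |H j y| ≤ K)
    (hw : ∀ (j : Fin N) (ψ : RVec N → ℝ), ContDiff ℝ (⊤ : ℕ∞) ψ → HasCompactSupport ψ →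
      tsupport ψ ⊆ D → ∫ y in D, v y * fderiv ℝ ψ y (EuclideanSpace.single j 1)
        = - ∫ y in D, H j y * ψ y)
    {x y : RVec N} (hxy : segment ℝ x y ⊆ D) : |v x - v y| ≤ N * K * ‖x - y‖ := by
  have hcomp : IsCompact (segment ℝ x y) := by
    rw [segment_eq_image_lineMap]
    exact isCompact_Icc.image AffineMap.lineMap_continuous
  obtain ⟨δ, hδ, hδD⟩ := hcomp.exists_cthickening_subset_open hD hxy
  let b : ℕ → ContDiffBump (0 : RVec N) := fun n =>
    ⟨δ / (n + 2) , δ / (n + 1), by positivity,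
      div_lt_div_of_pos_left hδ (by positivity) (by linarith)⟩
  have hbδ : ∀ n, (b n).rOut ≤ δ := fun n =>
    div_le_self hδ.le (by simp)
  have hlim : Filter.Tendsto (fun n => (b n).rOut) Filter.atTop (nhds 0) := by
    have := (tendsto_one_div_add_atTop_nhds_zero_nat (𝕜 := ℝ)).const_mul δ
    simpa [b, div_eq_mul_inv] using this
  have hconv : ∀ z, Filter.Tendsto (fun n => ∫ t, v t * (b n).normed volume (z - t))
      Filter.atTop (nhds (v z)) := by
    intro z
    have := ContDiffBump.convolution_tendsto_right_of_continuous (μ := volume) hlim hv z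
    refine this.congr fun n => ?_
    rw [convolution_lsmul_swap]
    refine integral_congr_ae (Filter.Eventually.of_forall fun t => ?_)
    simp [mul_comm]
  have hbound : ∀ n, |(∫ t, v t * (b n).normed volume (x - t)) -
      ∫ t, v t * (b n).normed volume (y - t)| ≤ N * K * ‖x - y‖ := by
    intro n
    have hT : ∀ z ∈ segment ℝ x y, ∃ T : RVec N →L[ℝ] ℝ,
        HasFDerivAt (fun z => ∫ t, v t * (b n).normed volume (z - t)) T z ∧ ‖T‖ ≤ N * K := by
      intro z hz
      refine norm_fderiv_mollification_le hv hK0 hK hw (b n) (Subset.trans ?_ hδD)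
      exact (Metric.closedBall_subset_closedBall (hbδ n)).trans
        (Metric.closedBall_subset_cthickening hz δ)
    choose! T hT1 hT2 using hT
    have := (convex_segment (𝕜 := ℝ) x y).norm_image_sub_le_of_norm_hasFDerivWithin_le
      (fun z hz => (hT1 z hz).hasFDerivWithinAt) hT2 (right_mem_segment ℝ x y)
      (left_mem_segment ℝ x y)
    exact this
  exact le_of_tendsto ((hconv x).sub (hconv y)).abs (Filter.Eventually.of_forall hbound)

/-- A continuous function that vanishes off `D` and is Lipschitz along the segments in `D` is
Lipschitz. -/
theorem abs_sub_le_of_segment {D : Set (RVec N)} (hD : IsOpen D)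
    {v : RVec N → ℝ} (hv : Continuous v) (h0 : ∀ y ∉ D, v y = 0) {C : ℝ} (hC : 0 ≤ C)
    (hseg : ∀ x y, segment ℝ x y ⊆ D → |v x - v y| ≤ C * ‖x - y‖) (x y : RVec N) :
    |v x - v y| ≤ C * ‖x - y‖ := by
  -- Replace `z` by a point `w` of the complement nearest to `x`. The segment from `x` to `w`,
  -- without `w`, lies in a ball contained in `D`, so the hypothesis applies up to every point
  -- before `w` and passes to the limit by continuity.
  have hout : ∀ x z, z ∉ D → |v x| ≤ C * ‖x - z‖ := by
    intro x z hz
    by_cases hx : x ∈ D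
    swap
    · rw [h0 x hx, abs_zero]; positivity
    obtain ⟨w, hw, hwd⟩ := hD.isClosed_compl.exists_infDist_eq_dist ⟨z, hz⟩ x
    have hle : dist x w ≤ dist x z := hwd ▸ Metric.infDist_le_dist_of_mem hz
    have hball : Metric.ball x (dist x w) ⊆ D := by
      rw [← hwd]
      intro p hp
      by_contra hpD
      have := Metric.infDist_le_dist_of_mem (x := x) (show p ∈ Dᶜ from hpD)
      rw [Metric.mem_ball, dist_comm] at hp
      linarith
    have hpos : 0 < dist x w := by
      rw [dist_pos]; rintro rfl; exact hw hx
    have hlim : Filter.Tendsto (fun t : ℝ => |v x - v (AffineMap.lineMap x w t)|)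
        (nhdsWithin 1 (Iio 1)) (nhds |v x - v w|) := by
      have hc : Continuous fun t : ℝ => |v x - v (AffineMap.lineMap x w t)| :=
        (continuous_const.sub (hv.comp AffineMap.lineMap_continuous)).abs
      have := hc.tendsto 1
      simp only [AffineMap.lineMap_apply_one] at this
      exact this.mono_left nhdsWithin_le_nhds
    have hle' : |v x - v w| ≤ C * ‖x - w‖ := by
      refine le_of_tendsto hlim ?_
      filter_upwards [Ioo_mem_nhdsLT (zero_lt_one' ℝ)] with t ht
      have hd : dist x (AffineMap.lineMap x w t) = t * dist x w := by
        rw [dist_left_lineMap, Real.norm_of_nonneg ht.1.le]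
      have hlt : t * dist x w < dist x w := by nlinarith [ht.2]
      refine (hseg _ _ ?_).trans ?_
      · refine Subset.trans ?_ hball
        refine (convex_ball x _).segment_subset (Metric.mem_ball_self hpos) ?_
        rw [Metric.mem_ball, dist_comm, hd]; exact hlt
      · rw [← dist_eq_norm, ← dist_eq_norm, hd]
        exact mul_le_mul_of_nonneg_left hlt.le hC
    rw [h0 w hw, sub_zero] at hle'
    refine hle'.trans ?_
    rw [← dist_eq_norm, ← dist_eq_norm]
    exact mul_le_mul_of_nonneg_left hle hC
  by_cases h : segment ℝ x y ⊆ D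
  · exact hseg x y h
  obtain ⟨z, hz, hzD⟩ := not_subset.1 h
  have h1 := hout x z hzD
  have h2 := hout y z hzD
  -- The exit point `z` is on the segment, so the two estimates add up without loss in the constant.
  have h3 : dist x z + dist z y = dist x y := dist_add_dist_of_mem_segment hz
  rw [dist_comm z y, dist_eq_norm, dist_eq_norm, dist_eq_norm] at h3
  calc |v x - v y| ≤ |v x| + |v y| := abs_sub _ _
    _ ≤ C * ‖x - z‖ + C * ‖y - z‖ := add_le_add h1 h2
    _ = C * ‖x - y‖ := by rw [← h3]; ring

theorem lipschitzWith_of_component {u : RVec N → RVec m} {C : ℝ} (hC : 0 ≤ C)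
    (h : ∀ i x y, |u x i - u y i| ≤ C * ‖x - y‖) :
    LipschitzWith (Real.toNNReal (m * C)) u := by
  refine LipschitzWith.of_dist_le_mul fun x y => ?_
  rw [Real.coe_toNNReal _ (by positivity), dist_eq_norm, dist_eq_norm]
  conv_lhs => rw [← EuclideanSpace.sum_smul_single (u x - u y)]
  refine (norm_sum_le _ _).trans ?_
  calc ∑ i, ‖(u x - u y) i • EuclideanSpace.single i (1 : ℝ)‖
      ≤ ∑ _i : Fin m, C * ‖x - y‖ := by
        refine Finset.sum_le_sum fun i _ => ?_
        rw [norm_smul]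
        simpa using h i x y
    _ = m * C * ‖x - y‖ := by simp; ring

/-- Every element of `W^{1,∞}₀(D)` is, extended by zero, a Lipschitz map. -/
theorem IsW1InfZero.exists_lipschitzWith {D : Set (RVec N)} (hD : IsOpen D)
    {φ : RVec N → RVec m} {G : RVec N → RMat m N} (h : IsW1InfZero D φ G) :
    ∃ (u : RVec N → RVec m) (L : NNReal), LipschitzWith L u ∧ (∀ y ∉ D, u y = 0) ∧
      ∀ᵐ y ∂volume.restrict D, jac u y = G y := by
  set u : RVec N → RVec m := D.indicator φ with hu
  have huc : Continuous u := continuous_indicator h.boundary h.continuousOn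
  have hu0 : ∀ y ∉ D, u y = 0 := fun y hy => indicator_of_notMem hy φ
  have hud : ∀ y ∈ D, u y = φ y := fun y hy => indicator_of_mem hy φ
  have hci : ∀ i, Continuous fun y => u y i := fun i =>
    (EuclideanSpace.proj (𝕜 := ℝ) i).continuous.comp huc
  have hbd : ∀ i j, ∃ K : ℝ, ∀ᵐ y ∂volume.restrict D, |G y i j| ≤ K := by
    intro i j
    obtain ⟨K, hK⟩ := eLpNormEssSup_lt_top_iff_isBoundedUnder.1
      (by simpa [eLpNorm_exponent_top] using (h.memLp_grad i j).2)
    refine ⟨K, ?_⟩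
    filter_upwards [Filter.eventually_map.1 hK] with y hy
    exact_mod_cast hy
  choose K hK using hbd
  set K0 : ℝ := ∑ i, ∑ j, |K i j| with hK0
  have hK0nn : 0 ≤ K0 := by positivity
  have hKle : ∀ i j, K i j ≤ K0 := fun i j =>
    (le_abs_self _).trans ((Finset.single_le_sum (f := fun j => |K i j|)
      (fun _ _ => abs_nonneg _) (Finset.mem_univ j)).trans
      (Finset.single_le_sum (f := fun i => ∑ j, |K i j|)
      (fun _ _ => by positivity) (Finset.mem_univ i)))
  have hwk : ∀ (i : Fin m) (j : Fin N) (ψ : RVec N → ℝ), ContDiff ℝ (⊤ : ℕ∞) ψ →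
      HasCompactSupport ψ → tsupport ψ ⊆ D →
      ∫ y in D, u y i * fderiv ℝ ψ y (EuclideanSpace.single j 1)
        = - ∫ y in D, G y i j * ψ y := by
    intro i j ψ h1 h2 h3
    rw [← h.weakGradient i j ψ h1 h2 h3]
    refine setIntegral_congr_fun hD.measurableSet fun y hy => ?_
    simp only [hud y hy]
  have hLip : ∀ i x y, |u x i - u y i| ≤ (N * K0) * ‖x - y‖ := by
    intro i
    refine abs_sub_le_of_segment hD (hci i) (fun y hy => by simp [hu0 y hy]) (by positivity) ?_
    intro x y hxy
    refine abs_sub_le_of_segment_subset hD (hci i) (H := fun j y => G y i j) hK0nn ?_ ?_ hxy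
    · intro j
      filter_upwards [hK i j] with y hy
      exact hy.trans (hKle i j)
    · exact fun j => hwk i j
  have hL := lipschitzWith_of_component (by positivity) hLip
  refine ⟨u, _, hL, hu0, ?_⟩
  have hcomp : ∀ i j, ∀ᵐ y ∂volume.restrict D, jac u y i j = G y i j := by
    intro i j
    have hjm : MemLp (fun y => jac u y i j) ∞ (volume.restrict D) :=
      memLp_top_of_bound
        (((measurable_pi_iff.1 ((measurable_pi_iff.1 (measurable_jac u)) i) j)).aestronglyMeasurable)
        _ (Filter.Eventually.of_forall fun y => abs_jac_le hL y i j)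
    have hli : ∀ {g : RVec N → ℝ}, MemLp g ∞ (volume.restrict D) → LocallyIntegrableOn g D := by
      intro g hg
      exact locallyIntegrableOn_of_locallyIntegrable_restrict (hg.locallyIntegrable le_top)
    -- Both `jac u` and `G` are weak gradients of `u` in `D`, so the difference of their entries
    -- annihilates every test function.
    have key := hD.ae_eq_zero_of_integral_contDiff_smul_eq_zero
      (f := fun y => jac u y i j - G y i j) (μ := volume)
      ((hli hjm).sub (hli (h.memLp_grad i j))) ?_
    · rw [ae_restrict_iff' hD.measurableSet]
      filter_upwards [key] with y hy hyD
      linarith [hy hyD]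
    · intro ψ h1 h2 h3
      have i1 : Integrable ψ (volume.restrict D) :=
        (h1.continuous.integrable_of_hasCompactSupport h2).integrableOn
      have e1 := integral_component_mul_fderiv hL h1 h2 i j
      have e2 := hwk i j ψ h1 h2 h3
      have a1 : ∫ y in D, u y i * fderiv ℝ ψ y (EuclideanSpace.single j 1) =
          ∫ y, u y i * fderiv ℝ ψ y (EuclideanSpace.single j 1) :=
        setIntegral_eq_integral_of_forall_compl_eq_zero fun y hy => by simp [hu0 y hy]
      have z : ∀ (g : RVec N → ℝ), ∀ y ∉ D, g y * ψ y = 0 := fun g y hy => by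
        rw [image_eq_zero_of_notMem_tsupport fun h => hy (h3 h), mul_zero]
      have a2 : ∫ y in D, jac u y i j * ψ y = ∫ y, jac u y i j * ψ y :=
        setIntegral_eq_integral_of_forall_compl_eq_zero (z _)
      have a3 : ∫ y, ψ y • (jac u y i j - G y i j) =
          ∫ y in D, (jac u y i j * ψ y - G y i j * ψ y) := by
        rw [← setIntegral_eq_integral_of_forall_compl_eq_zero (s := D)]
        · exact integral_congr_ae (Filter.Eventually.of_forall fun y => by simp; ring)
        · intro y hy
          rw [smul_eq_mul, mul_comm]
          exact z (fun y => jac u y i j - G y i j) y hy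
      rw [a3, integral_sub]
      · linarith
      · exact i1.mul_of_top_right hjm
      · exact i1.mul_of_top_right (h.memLp_grad i j)
  have hall : ∀ᵐ y ∂volume.restrict D, ∀ i j, jac u y i j = G y i j :=
    ae_all_iff.2 fun i => ae_all_iff.2 fun j => hcomp i j
  filter_upwards [hall] with y hy
  ext i j
  exact hy i j

/-! ### Cubes and rescaling -/

/-- The open cube with lower corner `c` and side length `r`. -/
def cube {N : ℕ} (c : RVec N) (r : ℝ) : Set (RVec N) := {y | ∀ i, y i ∈ Ioo (c i) (c i + r)}

/-- The closed cube with lower corner `c` and side length `r`. -/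
def closedCube {N : ℕ} (c : RVec N) (r : ℝ) : Set (RVec N) :=
  {y | ∀ i, y i ∈ Icc (c i) (c i + r)}

theorem unitCube_eq_cube : unitCube N = cube 0 1 := by
  simp [unitCube, cube]

theorem continuous_coord (i : Fin N) : Continuous fun y : RVec N => y i :=
  (EuclideanSpace.proj (𝕜 := ℝ) i).continuous

theorem isOpen_cube (c : RVec N) (r : ℝ) : IsOpen (cube c r) := by
  simp only [cube, ofPred_forall]
  exact isOpen_iInter_of_finite fun i => isOpen_Ioo.preimage (continuous_coord i)

theorem isClosed_closedCube (c : RVec N) (r : ℝ) : IsClosed (closedCube c r) := by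
  simp only [closedCube, ofPred_forall]
  exact isClosed_iInter fun i => isClosed_Icc.preimage (continuous_coord i)

theorem cube_subset_closedCube (c : RVec N) (r : ℝ) : cube c r ⊆ closedCube c r :=
  fun _ hy i => Ioo_subset_Icc_self (hy i)

theorem convex_cube (c : RVec N) (r : ℝ) : Convex ℝ (cube c r) := by
  intro x hx y hy a b ha hb hab i
  exact convex_Ioo _ _ (hx i) (hy i) ha hb hab

theorem cube_eq_preimage (c : RVec N) (r : ℝ) :
    cube c r = (MeasurableEquiv.toLp 2 (Fin N → ℝ)).symm ⁻¹'
      (Set.univ.pi fun i => Ioo (c i) (c i + r)) := by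
  ext y; simp [cube]

theorem closedCube_eq_preimage (c : RVec N) (r : ℝ) :
    closedCube c r = (MeasurableEquiv.toLp 2 (Fin N → ℝ)).symm ⁻¹'
      (Set.univ.pi fun i => Icc (c i) (c i + r)) := by
  ext y; simp [closedCube, -pi_univ_Icc]

theorem volume_cube (c : RVec N) (r : ℝ) : volume (cube c r) = ENNReal.ofReal r ^ N := by
  rw [cube_eq_preimage, (EuclideanSpace.volume_preserving_symm_measurableEquiv_toLp
    (Fin N)).measure_preimage_equiv, Real.volume_pi_Ioo]
  simp

theorem volume_closedCube (c : RVec N) (r : ℝ) :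
    volume (closedCube c r) = ENNReal.ofReal r ^ N := by
  rw [closedCube_eq_preimage, (EuclideanSpace.volume_preserving_symm_measurableEquiv_toLp
    (Fin N)).measure_preimage_equiv, volume_pi_pi]
  simp

theorem closedCube_ae_eq_cube (c : RVec N) (r : ℝ) :
    volume (closedCube c r \ cube c r) = 0 := by
  rw [measure_sdiff (cube_subset_closedCube c r) (isOpen_cube c r).measurableSet.nullMeasurableSet
    (by rw [volume_cube]; exact ENNReal.pow_ne_top ENNReal.ofReal_ne_top),
    volume_cube, volume_closedCube, tsub_self]

theorem closedCube_subset_closedBall (c : RVec N) {r : ℝ} (hr : 0 ≤ r) :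
    closedCube c r ⊆ Metric.closedBall c (N * r) := by
  intro y hy
  rw [Metric.mem_closedBall, dist_eq_norm, ← EuclideanSpace.sum_smul_single (y - c)]
  refine (norm_sum_le _ _).trans ?_
  calc ∑ i, ‖(y - c) i • EuclideanSpace.single i (1 : ℝ)‖ ≤ ∑ _i : Fin N, r := by
        refine Finset.sum_le_sum fun i _ => ?_
        have := hy i
        rw [norm_smul]
        simp only [PiLp.sub_apply, PiLp.norm_single, norm_one, mul_one,
          Real.norm_eq_abs]
        rw [abs_le]
        constructor <;> linarith [this.1, this.2]
    _ = N * r := by simp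

/-- The factor `N + 1` is positive for every `N`, so the side of a cube can be found from a
prescribed radius by division. -/
theorem closedCube_subset_closedBall' (c : RVec N) {r : ℝ} (hr : 0 ≤ r) :
    closedCube c r ⊆ Metric.closedBall c ((N + 1) * r) :=
  (closedCube_subset_closedBall c hr).trans
    (Metric.closedBall_subset_closedBall (by linarith))

theorem isBounded_cube (c : RVec N) {r : ℝ} (hr : 0 ≤ r) : Bornology.IsBounded (cube c r) :=
  Metric.isBounded_closedBall.subset
    ((cube_subset_closedCube c r).trans (closedCube_subset_closedBall c hr))

theorem volume_cube_ne_top (c : RVec N) (r : ℝ) : volume (cube c r) ≠ ∞ := by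
  rw [volume_cube]; exact ENNReal.pow_ne_top ENNReal.ofReal_ne_top

theorem volume_cube_ne_zero (c : RVec N) {r : ℝ} (hr : 0 < r) : volume (cube c r) ≠ 0 := by
  rw [volume_cube]; exact pow_ne_zero _ (by simpa using hr)

theorem exists_subset_cube {s : Set (RVec N)} (hs : Bornology.IsBounded s) :
    ∃ c r, 0 < r ∧ s ⊆ cube (N := N) c r := by
  obtain ⟨R, hR⟩ := hs.subset_closedBall 0
  refine ⟨WithLp.toLp 2 fun _ => -(|R| + 1), 2 * (|R| + 1), by positivity, fun y hy i => ?_⟩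
  have h1 : ‖y‖ ≤ R := by simpa using hR hy
  have h2 : |y i| ≤ R := (PiLp.norm_apply_le y i).trans h1
  have h3 := abs_le.1 (h2.trans (le_abs_self R))
  simp only [mem_Ioo]
  constructor <;> linarith [h3.1, h3.2]

/-- The map `u` transported from the unit cube to the cube `cube c r`, with the same gradients. -/
noncomputable def rescale {m N : ℕ} (c : RVec N) (r : ℝ) (u : RVec N → RVec m) (z : RVec N) :
    RVec m :=
  r • u (r⁻¹ • (z - c))

theorem lipschitzWith_rescale {u : RVec N → RVec m} {L : NNReal} (hu : LipschitzWith L u)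
    (c : RVec N) {r : ℝ} (hr : 0 < r) : LipschitzWith L (rescale c r u) := by
  refine LipschitzWith.of_dist_le_mul fun x y => ?_
  have h := hu.dist_le_mul (r⁻¹ • (x - c)) (r⁻¹ • (y - c))
  simp only [rescale, dist_smul₀, dist_sub_right, Real.norm_eq_abs, abs_of_pos hr, norm_inv] at h ⊢
  calc r * dist (u (r⁻¹ • (x - c))) (u (r⁻¹ • (y - c))) ≤ r * (L * (r⁻¹ * dist x y)) :=
        mul_le_mul_of_nonneg_left h hr.le
    _ = L * dist x y := by field_simp

theorem jac_rescale (u : RVec N → RVec m) (c : RVec N) {r : ℝ} (hr : r ≠ 0) (z : RVec N) :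
    jac (rescale c r u) z = jac u (r⁻¹ • (z - c)) := by
  have h1 : rescale c r u = r • fun z => (fun w => u (r⁻¹ • w)) (z - c) := rfl
  have h2 : fderiv ℝ (rescale c r u) z = fderiv ℝ u (r⁻¹ • (z - c)) := by
    have h3 : fderiv ℝ (fun w => u (r⁻¹ • w)) (z - c) = r⁻¹ • fderiv ℝ u (r⁻¹ • (z - c)) :=
      fderiv_comp_smul r⁻¹
    have h4 : fderiv ℝ (fun z => (fun w => u (r⁻¹ • w)) (z - c)) z =
        fderiv ℝ (fun w => u (r⁻¹ • w)) (z - c) :=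
      fderiv_comp_sub (f := fun w => u (r⁻¹ • w)) c
    rw [h1, fderiv_const_smul_field, Pi.smul_apply, h4, h3, smul_smul, mul_inv_cancel₀ hr,
      one_smul]
  simp only [jac, h2]

theorem mem_cube_iff {c : RVec N} {r : ℝ} (hr : 0 < r) (z : RVec N) :
    z ∈ cube c r ↔ r⁻¹ • (z - c) ∈ unitCube N := by
  simp only [cube, unitCube, mem_ofPred_eq, mem_Ioo, PiLp.smul_apply, PiLp.sub_apply, smul_eq_mul]
  refine forall_congr' fun i => ?_
  rw [inv_mul_lt_iff₀ hr, lt_inv_mul_iff₀ hr]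
  constructor <;> rintro ⟨h1, h2⟩ <;> constructor <;> linarith

theorem rescale_eq_zero {u : RVec N → RVec m} (h0 : ∀ y ∉ unitCube N, u y = 0) {c : RVec N} {r : ℝ}
    (hr : 0 < r) {z : RVec N} (hz : z ∉ cube c r) : rescale c r u z = 0 := by
  rw [rescale, h0 _ (fun h => hz ((mem_cube_iff hr z).2 h)), smul_zero]

theorem lintegral_comp_rescale (F : RVec N → ℝ≥0∞) (c : RVec N) {r : ℝ} (hr : 0 < r) :
    ∫⁻ z in cube c r, F (r⁻¹ • (z - c)) = volume (cube c r) * ∫⁻ y in unitCube N, F y := by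
  have hu : MeasurableSet (unitCube N) := by
    rw [unitCube_eq_cube]; exact (isOpen_cube _ _).measurableSet
  rw [← lintegral_indicator (isOpen_cube c r).measurableSet, ← lintegral_indicator hu]
  have e1 : ∀ z, (cube c r).indicator (fun z => F (r⁻¹ • (z - c))) z =
      (unitCube N).indicator F (r⁻¹ • (z - c)) := by
    intro z
    by_cases hz : z ∈ cube c r
    · rw [indicator_of_mem hz, indicator_of_mem ((mem_cube_iff hr z).1 hz)]
    · rw [indicator_of_notMem hz, indicator_of_notMem fun h => hz ((mem_cube_iff hr z).2 h)]
  simp only [e1]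
  rw [lintegral_sub_right_eq_self (fun z => (unitCube N).indicator F (r⁻¹ • z)) c]
  -- Along a measurable embedding the change of variables holds for an arbitrary integrand `F`.
  have hemb : MeasurableEmbedding fun z : RVec N => r⁻¹ • z :=
    measurableEmbedding_const_smul₀ (inv_ne_zero hr.ne')
  rw [← hemb.lintegral_map, Measure.map_addHaar_smul _ (inv_ne_zero hr.ne'), lintegral_smul_measure,
    volume_cube, smul_eq_mul, finrank_euclideanSpace, Fintype.card_fin, inv_pow, inv_inv,
    abs_of_pos (pow_pos hr N), ENNReal.ofReal_pow hr.le]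

/-! ### Lipschitz competitors for `𝒵f` on arbitrary cubes -/

section Envelope

variable {f : RVec N → RMat m N → ℝ≥0∞} {x : RVec N}

theorem ZEnvelope_le_lintegral {ξ : RMat m N} {u : RVec N → RVec m} {L : NNReal}
    (hu : LipschitzWith L u) (h0 : ∀ y ∉ unitCube N, u y = 0) :
    ZEnvelope f x ξ ≤ ∫⁻ y in unitCube N, f x (ξ + jac u y) := by
  have hY : IsOpen (unitCube N) := by rw [unitCube_eq_cube]; exact isOpen_cube _ _
  have hb : Bornology.IsBounded (unitCube N) := by
    rw [unitCube_eq_cube]; exact isBounded_cube _ zero_le_one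
  exact iInf_le_of_le u (iInf_le_of_le (jac u) (iInf_le _ (hu.isW1InfZero hY hb h0)))

theorem exists_lipschitzWith_lintegral_lt {ξ : RMat m N} {a : ℝ≥0∞} (h : ZEnvelope f x ξ < a) :
    ∃ (u : RVec N → RVec m) (L : NNReal), LipschitzWith L u ∧ (∀ y ∉ unitCube N, u y = 0) ∧
      ∫⁻ y in unitCube N, f x (ξ + jac u y) < a := by
  have hY : IsOpen (unitCube N) := by rw [unitCube_eq_cube]; exact isOpen_cube _ _
  simp only [ZEnvelope, iInf_lt_iff] at h
  obtain ⟨φ, G, hφ, hlt⟩ := h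
  obtain ⟨u, L, hL, h0, hj⟩ := hφ.exists_lipschitzWith hY
  refine ⟨u, L, hL, h0, lt_of_le_of_lt (le_of_eq ?_) hlt⟩
  refine lintegral_congr_ae ?_
  filter_upwards [hj] with y hy
  rw [hy]

/-- The infimum defining `𝒵f` does not depend on the cube, since `rescale` preserves gradients and
only multiplies the integral by the volume. -/
theorem ZEnvelope_mul_volume_cube_le {ξ : RMat m N} {u : RVec N → RVec m} {L : NNReal}
    (hu : LipschitzWith L u) {c : RVec N} {r : ℝ} (hr : 0 < r) (h0 : ∀ y ∉ cube c r, u y = 0) :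
    volume (cube c r) * ZEnvelope f x ξ ≤ ∫⁻ y in cube c r, f x (ξ + jac u y) := by
  have hr' : 0 < r⁻¹ := inv_pos.2 hr
  -- The inverse transport, from `cube c r` back to the unit cube, is again a `rescale`, with corner
  -- `-c/r` and factor `1/r`.
  set v := rescale (-(r⁻¹ • c)) r⁻¹ u with hv
  have harg : ∀ z : RVec N, r⁻¹⁻¹ • (r⁻¹ • (z - c) - -(r⁻¹ • c)) = z := by
    intro z
    rw [inv_inv, smul_sub r⁻¹, sub_neg_eq_add, sub_add_cancel, smul_smul, mul_inv_cancel₀ hr.ne',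
      one_smul]
  have hsurj : ∀ y : RVec N, ∃ z, y = r⁻¹ • (z - c) := fun y =>
    ⟨r • y + c, by rw [add_sub_cancel_right, smul_smul, inv_mul_cancel₀ hr.ne', one_smul]⟩
  have hv0 : ∀ y ∉ unitCube N, v y = 0 := by
    intro y hy
    obtain ⟨z, rfl⟩ := hsurj y
    rw [← mem_cube_iff hr] at hy
    rw [hv, rescale, harg, h0 z hy, smul_zero]
  have hjac : ∀ z, jac v (r⁻¹ • (z - c)) = jac u z := by
    intro z
    rw [hv, jac_rescale _ _ hr'.ne', harg]
  have key := lintegral_comp_rescale (fun y => f x (ξ + jac v y)) c hr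
  simp only [hjac] at key
  rw [key]
  exact mul_le_mul_right (ZEnvelope_le_lintegral (lipschitzWith_rescale hu _ hr') hv0) _

end Envelope

/-! ### Gluing, and filling by small cubes -/

/-- The matrix of a linear map `ℝᴺ → ℝᵐ`. -/
noncomputable def linMat {m N : ℕ} (T : RVec N →L[ℝ] RVec m) : RMat m N :=
  Matrix.of fun i j => T (EuclideanSpace.single j 1) i

theorem jac_eq_linMat {u : RVec N → RVec m} {T : RVec N →L[ℝ] RVec m} {y : RVec N}
    (h : HasFDerivAt u T y) : jac u y = linMat T := by
  simp only [jac, linMat, h.fderiv]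

theorem hasFDerivAt_of_eventually_affine {u : RVec N → RVec m} {T : RVec N →L[ℝ] RVec m}
    {c z : RVec N} (h : ∀ᶠ w in nhds z, u w = u c + T (w - c)) : HasFDerivAt u T z := by
  have h1 : HasFDerivAt (fun w => u c + T (w - c)) T z := by
    have h2 : HasFDerivAt (fun w => w - c) (ContinuousLinearMap.id ℝ (RVec N)) z :=
      (hasFDerivAt_id z).sub_const c
    simpa using (T.hasFDerivAt.comp z h2).const_add (u c)
  exact h1.congr_of_eventuallyEq h

/-- Lipschitz maps supported in pairwise disjoint sets can be glued together. -/
theorem exists_lipschitzWith_glue {κ : Type*} {V : Set κ} {C : κ → Set (RVec N)}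
    (hC : V.PairwiseDisjoint C) {φ : κ → RVec N → RVec m} {L : NNReal}
    (hφ : ∀ a ∈ V, LipschitzWith L (φ a)) (h0 : ∀ a ∈ V, ∀ z ∉ C a, φ a z = 0) :
    ∃ Φ : RVec N → RVec m, LipschitzWith (2 * L) Φ ∧ (∀ a ∈ V, ∀ z ∈ C a, Φ z = φ a z) ∧
      ∀ z, (∀ a ∈ V, z ∉ C a) → Φ z = 0 := by
  classical
  let Φ : RVec N → RVec m := fun z => if h : ∃ a ∈ V, z ∈ C a then φ h.choose z else 0
  have hΦ1 : ∀ a ∈ V, ∀ z ∈ C a, Φ z = φ a z := by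
    intro a ha z hz
    have h : ∃ a ∈ V, z ∈ C a := ⟨a, ha, hz⟩
    have hcs := h.choose_spec
    have : h.choose = a := hC.elim hcs.1 ha (not_disjoint_iff.2 ⟨z, hcs.2, hz⟩)
    simp only [Φ, dif_pos h, this]
  have hΦ2 : ∀ z, (∀ a ∈ V, z ∉ C a) → Φ z = 0 := by
    intro z hz
    exact dif_neg (by push Not; exact hz)
  refine ⟨Φ, ?_, hΦ1, hΦ2⟩
  have hLL : ∀ x y : RVec N, (L : ℝ) * dist x y ≤ 2 * L * dist x y := fun x y => by
    linarith [mul_nonneg L.coe_nonneg (dist_nonneg (x := x) (y := y))]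
  have hone : ∀ a ∈ V, ∀ x ∈ C a, ∀ y, (∀ b ∈ V, y ∉ C b) →
      dist (Φ x) (Φ y) ≤ L * dist x y := by
    intro a ha x hx y hy
    rw [hΦ1 a ha x hx, hΦ2 y hy, ← h0 a ha y (hy a ha)]
    exact (hφ a ha).dist_le_mul x y
  refine LipschitzWith.of_dist_le_mul fun x y => ?_
  push_cast
  by_cases hx : ∃ a ∈ V, x ∈ C a <;> by_cases hy : ∃ a ∈ V, y ∈ C a
  · obtain ⟨a, ha, hxa⟩ := hx
    obtain ⟨b, hb, hyb⟩ := hy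
    rw [hΦ1 a ha x hxa, hΦ1 b hb y hyb]
    by_cases hab : a = b
    · subst hab
      exact ((hφ a ha).dist_le_mul x y).trans (hLL x y)
    -- For points of different cells each map vanishes at the point of the other cell. Passing
    -- through the value `0` costs the factor `2`.
    · have hya : y ∉ C a := fun h => hab (hC.elim ha hb (not_disjoint_iff.2 ⟨y, h, hyb⟩))
      have hxb : x ∉ C b := fun h => hab (hC.elim ha hb (not_disjoint_iff.2 ⟨x, hxa, h⟩))
      have e1 := (hφ a ha).dist_le_mul x y
      have e2 := (hφ b hb).dist_le_mul x y
      rw [h0 a ha y hya] at e1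
      rw [h0 b hb x hxb] at e2
      linarith [dist_triangle (φ a x) 0 (φ b y)]
  · obtain ⟨a, ha, hxa⟩ := hx
    push Not at hy
    exact (hone a ha x hxa y hy).trans (hLL x y)
  · obtain ⟨b, hb, hyb⟩ := hy
    push Not at hx
    rw [dist_comm, dist_comm x y]
    exact (hone b hb y hyb x hx).trans (hLL y x)
  · push Not at hx hy
    rw [hΦ2 x hx, hΦ2 y hy, dist_self]
    positivity

/-- An open set, up to a null set, on which `u` is locally affine can be filled with small cubes on
each of which `u` is affine. -/
theorem exists_cubes_affine {Q : Set (RVec N)} (hQ : IsOpen Q) {u : RVec N → RVec m}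
    {A : Set (RVec N →L[ℝ] RVec m)}
    (hA : ∀ᵐ y ∂volume.restrict Q, ∃ T ∈ A, ∀ᶠ z in nhds y, u z = u y + T (z - y)) :
    ∃ V : Set (RVec N × ℝ × (RVec N →L[ℝ] RVec m)), V.Countable ∧
      V.PairwiseDisjoint (fun a => cube a.1 a.2.1) ∧
      (∀ a ∈ V, 0 < a.2.1 ∧ cube a.1 a.2.1 ⊆ Q ∧ a.2.2 ∈ A ∧
        ∀ z ∈ cube a.1 a.2.1, u z = u a.1 + a.2.2 (z - a.1)) ∧
      volume (Q \ ⋃ a ∈ V, cube a.1 a.2.1) = 0 := by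
  let t : Set (RVec N × ℝ × (RVec N →L[ℝ] RVec m)) :=
    {a | 0 < a.2.1 ∧ closedCube a.1 a.2.1 ⊆ Q ∧ a.2.2 ∈ A ∧
      ∀ z ∈ closedCube a.1 a.2.1, u z = u a.1 + a.2.2 (z - a.1)}
  let S : Set (RVec N) := {y | y ∈ Q ∧ ∃ T ∈ A, ∀ᶠ z in nhds y, u z = u y + T (z - y)}
  have hN1 : (0 : ℝ) < N + 1 := by positivity
  obtain ⟨V, hVt, hVc, hVd, hV0⟩ := Vitali.exists_disjoint_covering_ae
    (volume : Measure (RVec N)) S t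
    -- This is the volume of a ball of radius `3 (N + 1) r` divided by the volume `r ^ N` of a cube
    -- of side `r`. The lower corner of the cube serves as the centre of the ball.
    (ENNReal.ofReal (3 * (N + 1)) ^ N * volume (Metric.ball (0 : RVec N) 1)).toNNReal
    (fun a => (N + 1) * a.2.1) (fun a => a.1) (fun a => closedCube a.1 a.2.1)
    (fun a ha => closedCube_subset_closedBall' _ ha.1.le)
    (fun a ha => by
      rw [ENNReal.coe_toNNReal, volume_closedCube,
        Measure.addHaar_closedBall _ _ (by have := ha.1; positivity), finrank_euclideanSpace,
        Fintype.card_fin, ← mul_assoc, ENNReal.ofReal_pow (by have := ha.1; positivity),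
        ENNReal.ofReal_mul (by positivity : (0 : ℝ) ≤ 3 * (N + 1)), mul_pow]
      · exact le_of_eq (by ring)
      · exact ENNReal.mul_ne_top (ENNReal.pow_ne_top ENNReal.ofReal_ne_top)
          measure_ball_lt_top.ne)
    (fun a ha => by
      refine Set.Nonempty.mono (interior_maximal (cube_subset_closedCube _ _) (isOpen_cube _ _)) ?_
      refine ⟨WithLp.toLp 2 fun i => a.1 i + a.2.1 / 2, fun i => ?_⟩
      have := ha.1
      simp only [mem_Ioo]
      constructor <;> linarith)
    (fun a _ => isClosed_closedCube _ _)
    (fun y hy ε hε => by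
      obtain ⟨hyQ, T, hT, hyT⟩ := hy
      obtain ⟨δ, hδ, hδs⟩ := Metric.eventually_nhds_iff_ball.1 (hyT.and (hQ.mem_nhds hyQ))
      set ρ : ℝ := min (δ / 2) ε / (N + 1) with hρ
      have hρ0 : 0 < ρ := div_pos (lt_min (by positivity) hε) hN1
      have hρe : (N + 1) * ρ = min (δ / 2) ε := by rw [hρ]; field_simp
      have hsub : closedCube y ρ ⊆ Metric.ball y δ := by
        refine (closedCube_subset_closedBall' y hρ0.le).trans (Metric.closedBall_subset_ball ?_)
        rw [hρe]
        exact (min_le_left _ _).trans_lt (by linarith)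
      refine ⟨(y, ρ, T), ⟨hρ0, fun z hz => (hδs z (hsub hz)).2, hT,
        fun z hz => (hδs z (hsub hz)).1⟩, ?_, rfl⟩
      simp only [hρe]
      exact min_le_right _ _)
  refine ⟨V, hVc, fun a ha b hb hab => (hVd ha hb hab).mono (cube_subset_closedCube _ _)
    (cube_subset_closedCube _ _), fun a ha => ?_, ?_⟩
  · obtain ⟨h1, h2, h3, h4⟩ := hVt ha
    exact ⟨h1, (cube_subset_closedCube _ _).trans h2, h3,
      fun z hz => h4 z (cube_subset_closedCube _ _ hz)⟩
  · have hQS : volume (Q \ S) = 0 := by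
      rw [ae_restrict_iff' hQ.measurableSet, ae_iff] at hA
      refine measure_mono_null (fun y hy => ?_) hA
      simp only [mem_ofPred_eq, not_forall]
      exact ⟨hy.1, fun h => hy.2 ⟨hy.1, h⟩⟩
    -- The Vitali theorem is applied to closed cubes; passing to the open ones loses countably many
    -- null boundaries.
    have hB : volume (⋃ a ∈ V, closedCube a.1 a.2.1 \ cube a.1 a.2.1) = 0 :=
      (measure_biUnion_null_iff hVc).2 fun a _ => closedCube_ae_eq_cube _ _
    refine measure_mono_null ?_ (measure_union_null (measure_union_null hQS hV0) hB)
    intro y hy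
    by_cases hyS : y ∈ S
    swap
    · exact Or.inl (Or.inl ⟨hy.1, hyS⟩)
    by_cases hyB : y ∈ ⋃ a ∈ V, closedCube a.1 a.2.1
    swap
    · exact Or.inl (Or.inr ⟨hyS, hyB⟩)
    refine Or.inr ?_
    obtain ⟨a, ha, hya⟩ := mem_iUnion₂.1 hyB
    exact mem_iUnion₂.2 ⟨a, ha, hya, fun h => hy.2 (mem_iUnion₂.2 ⟨a, ha, h⟩)⟩

/-! ### The quasiconvexity inequality of `𝒵f` for piecewise affine maps -/

section Envelope

variable {f : RVec N → RMat m N → ℝ≥0∞} {x : RVec N}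

/-- The quasiconvexity inequality on a cube, for piecewise affine maps. -/
theorem ZEnvelope_le_lintegral_of_piecewise_affine (hfin : ∀ ξ, ZEnvelope f x ξ < ∞)
    {ξ : RMat m N} {u : RVec N → RVec m} {L : NNReal} (hu : LipschitzWith L u) {c : RVec N} {r : ℝ}
    (hr : 0 < r) (h0 : ∀ y ∉ cube c r, u y = 0) {A : Set (RVec N →L[ℝ] RVec m)} (hAf : A.Finite)
    (hA : ∀ᵐ y ∂volume.restrict (cube c r),
      ∃ T ∈ A, ∀ᶠ z in nhds y, u z = u y + T (z - y)) :
    volume (cube c r) * ZEnvelope f x ξ ≤ ∫⁻ y in cube c r, ZEnvelope f x (ξ + jac u y) := by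
  obtain ⟨V, hVc, hVd, hV, hV0⟩ := exists_cubes_affine (isOpen_cube c r) hA
  have main : ∀ ε : ℝ≥0∞, ε ≠ 0 → volume (cube c r) * ZEnvelope f x ξ ≤
      ∫⁻ y in cube c r, (ZEnvelope f x (ξ + jac u y) + ε) := by
    intro ε hε
    have hψ : ∀ T : RVec N →L[ℝ] RVec m, ∃ (ψ : RVec N → RVec m) (K : NNReal),
        LipschitzWith K ψ ∧ (∀ y ∉ unitCube N, ψ y = 0) ∧
        ∫⁻ y in unitCube N, f x (ξ + linMat T + jac ψ y) ≤ ZEnvelope f x (ξ + linMat T) + ε := by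
      intro T
      obtain ⟨ψ, K, h1, h2, h3⟩ := exists_lipschitzWith_lintegral_lt
        (ENNReal.lt_add_right (hfin (ξ + linMat T)).ne hε)
      exact ⟨ψ, K, h1, h2, h3.le⟩
    choose ψ K hψL hψ0 hψi using hψ
    -- Finitely many gradients call for finitely many competitors `ψ T`. This is what gives the
    -- infinitely many glued pieces a common Lipschitz constant.
    obtain ⟨K0, hK0⟩ := (hAf.image K).bddAbove
    obtain ⟨Φ, hΦL, hΦ1, hΦ0⟩ := exists_lipschitzWith_glue hVd
      (φ := fun a => rescale a.1 a.2.1 (ψ a.2.2)) (L := K0)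
      (fun a ha => (lipschitzWith_rescale (hψL _) _ (hV a ha).1).weaken
        (hK0 ⟨_, (hV a ha).2.2.1, rfl⟩))
      (fun a ha z hz => rescale_eq_zero (hψ0 _) (hV a ha).1 hz)
    have hjac : ∀ a ∈ V, ∀ z ∈ cube a.1 a.2.1, jac u z = linMat a.2.2 := by
      intro a ha z hz
      refine jac_eq_linMat (hasFDerivAt_of_eventually_affine (c := a.1) ?_)
      filter_upwards [(isOpen_cube _ _).mem_nhds hz] with w hw using (hV a ha).2.2.2 w hw
    -- On one cell `∇u` is constant and `Φ` is a rescaled copy of a competitor that is optimal for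
    -- it up to `ε`.
    have hcell : ∀ a ∈ V, ∫⁻ z in cube a.1 a.2.1, f x (ξ + jac (fun z => u z + Φ z) z) ≤
        ∫⁻ z in cube a.1 a.2.1, (ZEnvelope f x (ξ + jac u z) + ε) := by
      intro a ha
      have hm := (isOpen_cube a.1 a.2.1).measurableSet
      have e1 : ∫⁻ z in cube a.1 a.2.1, f x (ξ + jac (fun z => u z + Φ z) z) =
          ∫⁻ z in cube a.1 a.2.1,
            f x (ξ + linMat a.2.2 + jac (ψ a.2.2) (a.2.1⁻¹ • (z - a.1))) := by
        refine lintegral_congr_ae ((ae_restrict_iff' hm).2 ?_)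
        filter_upwards [(lipschitzWith_rescale (hψL a.2.2) a.1 (hV a ha).1).ae_differentiableAt
          (μ := volume)] with z hz hza
        have hz1 : HasFDerivAt u a.2.2 z := by
          refine hasFDerivAt_of_eventually_affine (c := a.1) ?_
          filter_upwards [(isOpen_cube _ _).mem_nhds hza] with w hw using (hV a ha).2.2.2 w hw
        have hz2 : HasFDerivAt Φ (fderiv ℝ (rescale a.1 a.2.1 (ψ a.2.2)) z) z := by
          refine hz.hasFDerivAt.congr_of_eventuallyEq ?_
          filter_upwards [(isOpen_cube _ _).mem_nhds hza] with w hw using hΦ1 a ha w hw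
        have hz3 : jac (fun z => u z + Φ z) z =
            linMat a.2.2 + jac (rescale a.1 a.2.1 (ψ a.2.2)) z := by
          rw [jac_eq_linMat (u := fun z => u z + Φ z) (hz1.add hz2)]
          ext i j
          simp [linMat, jac]
        rw [hz3, jac_rescale _ _ (hV a ha).1.ne', add_assoc]
      have e2 : ∫⁻ z in cube a.1 a.2.1, (ZEnvelope f x (ξ + jac u z) + ε) =
          ∫⁻ _z in cube a.1 a.2.1, (ZEnvelope f x (ξ + linMat a.2.2) + ε) :=
        setLIntegral_congr_fun hm fun z hz => by simp only [hjac a ha z hz]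
      rw [e1, e2, lintegral_comp_rescale
        (fun y => f x (ξ + linMat a.2.2 + jac (ψ a.2.2) y)) a.1 (hV a ha).1,
        setLIntegral_const, mul_comm (volume _)]
      exact mul_le_mul_left (hψi _) _
    have hmeas : ∀ a ∈ V, MeasurableSet (cube a.1 a.2.1) :=
      fun a _ => (isOpen_cube _ _).measurableSet
    have hae : (cube c r : Set (RVec N)) ≤ᵐ[volume] ⋃ a ∈ V, cube a.1 a.2.1 := by
      rw [ae_le_set]; exact hV0
    calc volume (cube c r) * ZEnvelope f x ξ
        ≤ ∫⁻ z in cube c r, f x (ξ + jac (fun z => u z + Φ z) z) := by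
          refine ZEnvelope_mul_volume_cube_le (hu.add hΦL) hr fun y hy => ?_
          rw [h0 y hy, hΦ0 y fun a ha h => hy ((hV a ha).2.1 h), add_zero]
      _ ≤ ∫⁻ z in ⋃ a ∈ V, cube a.1 a.2.1, f x (ξ + jac (fun z => u z + Φ z) z) :=
          lintegral_mono_set' hae
      _ = ∑' a : V, ∫⁻ z in cube a.1.1 a.1.2.1, f x (ξ + jac (fun z => u z + Φ z) z) :=
          lintegral_biUnion hVc hmeas hVd _
      _ ≤ ∑' a : V, ∫⁻ z in cube a.1.1 a.1.2.1, (ZEnvelope f x (ξ + jac u z) + ε) :=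
          ENNReal.tsum_le_tsum fun a => hcell a a.2
      _ = ∫⁻ z in ⋃ a ∈ V, cube a.1 a.2.1, (ZEnvelope f x (ξ + jac u z) + ε) :=
          (lintegral_biUnion hVc hmeas hVd _).symm
      _ ≤ ∫⁻ z in cube c r, (ZEnvelope f x (ξ + jac u z) + ε) :=
          lintegral_mono_set (iUnion₂_subset fun a ha => (hV a ha).2.1)
  have hv0 := volume_cube_ne_zero c hr
  have hvt := volume_cube_ne_top c r
  refine ENNReal.le_of_forall_pos_le_add fun ε hε _ => ?_
  have h := main (ε / volume (cube c r))
    (ENNReal.div_ne_zero.2 ⟨by exact_mod_cast hε.ne', hvt⟩)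
  rwa [lintegral_add_right _ measurable_const, setLIntegral_const,
    ENNReal.div_mul_cancel hv0 hvt] at h

/-- Passing from a cube to an arbitrary open subset. -/
theorem volume_mul_le_of_cube {g : RMat m N → ℝ≥0∞} {ξ : RMat m N} (hg : g ξ ≠ ∞)
    {D : Set (RVec N)} (hD : IsOpen D) (hfr : volume (frontier D) = 0) {u : RVec N → RVec m}
    (h0 : ∀ y ∉ D, u y = 0) {c : RVec N} {r : ℝ} (hDQ : D ⊆ cube c r)
    (h : volume (cube c r) * g ξ ≤ ∫⁻ y in cube c r, g (ξ + jac u y)) :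
    volume D * g ξ ≤ ∫⁻ y in D, g (ξ + jac u y) := by
  have hQm := (isOpen_cube c r).measurableSet
  -- Off the null set `frontier D`, `u` vanishes near every point outside `D`. The rest of the cube
  -- thus contributes the same amount to both sides, and this amount is finite because `g ξ` is, so
  -- it cancels.
  have hdiff : ∫⁻ y in cube c r \ D, g (ξ + jac u y) = volume (cube c r \ D) * g ξ := by
    rw [mul_comm, ← setLIntegral_const]
    refine lintegral_congr_ae ((ae_restrict_iff' (hQm.diff hD.measurableSet)).2 ?_)
    filter_upwards [measure_eq_zero_iff_ae_notMem.1 hfr] with y hy hyD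
    rw [jac_eq_zero_of_eventuallyEq_const (c := 0), add_zero]
    have hyc : y ∉ closure D := fun h => hy (by rw [hD.frontier_eq]; exact ⟨h, hyD.2⟩)
    filter_upwards [isClosed_closure.isOpen_compl.mem_nhds hyc] with z hz
    exact h0 z fun h => hz (subset_closure h)
  have hsplit := lintegral_inter_add_sdiff (μ := volume) (fun y => g (ξ + jac u y)) (cube c r)
    hD.measurableSet
  have hvol := measure_inter_add_sdiff (μ := volume) (cube c r) hD.measurableSet
  rw [inter_eq_self_of_subset_right hDQ] at hsplit hvol
  rw [← hsplit, ← hvol, hdiff, add_mul] at h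
  refine (ENNReal.add_le_add_iff_right (ENNReal.mul_ne_top ?_ hg)).1 h
  exact ne_top_of_le_ne_top (volume_cube_ne_top c r) (measure_mono sdiff_subset)

/-- The quasiconvexity inequality restricted to piecewise affine maps with finitely many
gradients. -/
def IsPiecewiseAffineQuasiconvex {m N : ℕ} (g : RMat m N → ℝ≥0∞) : Prop :=
  ∀ (ξ : RMat m N) (D : Set (RVec N)), IsOpen D → Bornology.IsBounded D →
    volume (frontier D) = 0 → ∀ (u : RVec N → RVec m) (L : NNReal), LipschitzWith L u →
    (∀ y ∉ D, u y = 0) → ∀ A : Set (RVec N →L[ℝ] RVec m), A.Finite →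
    (∀ᵐ y ∂volume.restrict D, ∃ T ∈ A, ∀ᶠ z in nhds y, u z = u y + T (z - y)) →
    volume D * g ξ ≤ ∫⁻ y in D, g (ξ + jac u y)

/-- Seen on a larger cube, `u` is still piecewise affine, with `0` as one additional gradient;
`volume_mul_le_of_cube` then returns to `D`. -/
theorem isPiecewiseAffineQuasiconvex_ZEnvelope (hfin : ∀ ξ, ZEnvelope f x ξ < ∞) :
    IsPiecewiseAffineQuasiconvex (ZEnvelope f x) := by
  intro ξ D hD hDb hfr u L hu h0 A hAf hA
  obtain ⟨c, r, hr, hDQ⟩ := exists_subset_cube hDb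
  refine volume_mul_le_of_cube (hfin ξ).ne hD hfr h0 hDQ
    (ZEnvelope_le_lintegral_of_piecewise_affine hfin hu hr (fun y hy => h0 y fun h => hy (hDQ h))
      (hAf.insert 0) (ae_restrict_of_ae ?_))
  rw [ae_restrict_iff' hD.measurableSet] at hA
  filter_upwards [hA, measure_eq_zero_iff_ae_notMem.1 hfr] with y hy hyf
  by_cases hyD : y ∈ D
  · obtain ⟨T, hT, h⟩ := hy hyD
    exact ⟨T, mem_insert_of_mem _ hT, h⟩
  · have hyc : y ∉ closure D := fun h => hyf (by rw [hD.frontier_eq]; exact ⟨h, hyD⟩)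
    refine ⟨0, mem_insert _ _, ?_⟩
    filter_upwards [isClosed_closure.isOpen_compl.mem_nhds hyc] with z hz
    simp [h0 y hyD, h0 z fun h => hz (subset_closure h)]

end Envelope

/-! ### Pyramids and convexity inequalities along rows -/

/-- The matrix whose `i`-th row is `b` and whose other rows vanish. -/
def rowMat {m N : ℕ} (i : Fin m) (b : RVec N) : RMat m N :=
  Matrix.of fun i' j => if i' = i then b j else 0

theorem rowMat_injective (i : Fin m) : Function.Injective (rowMat (N := N) i) := by
  intro b b' h
  ext j
  have := congrFun (congrFun h i) j
  simpa [rowMat] using this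

theorem linMat_smulRight (i : Fin m) (b : RVec N) :
    linMat ((innerSL ℝ b).smulRight (EuclideanSpace.single i (1 : ℝ))) = rowMat i b := by
  ext i' j
  simp [linMat, rowMat, EuclideanSpace.inner_single_right]

theorem volume_inner_eq {b : RVec N} (h : b ≠ 0) (c : ℝ) :
    volume {y : RVec N | inner ℝ b y = c} = 0 := by
  have hker : volume {y : RVec N | inner ℝ b y = 0} = 0 := by
    have h1 : {y : RVec N | inner ℝ b y = 0} =
        (LinearMap.ker (innerSL ℝ b).toLinearMap : Set (RVec N)) := by
      ext y
      simp
    rw [h1]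
    refine Measure.addHaar_submodule _ _ fun htop => h ?_
    have h2 : b ∈ LinearMap.ker (innerSL ℝ b).toLinearMap := htop ▸ Submodule.mem_top
    exact inner_self_eq_zero.1 (LinearMap.mem_ker.1 h2 : inner ℝ b b = 0)
  have hb : inner ℝ b b ≠ 0 := inner_self_ne_zero.2 h
  have h3 : {y : RVec N | inner ℝ b y = c} =
      (fun y => y + (-(c / inner ℝ b b)) • b) ⁻¹' {y : RVec N | inner ℝ b y = 0} := by
    ext y
    simp only [mem_ofPred_eq, mem_preimage, inner_add_right, inner_smul_right]
    rw [neg_mul, div_mul_cancel₀ _ hb, ← sub_eq_add_neg, sub_eq_zero]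
  rw [h3, measure_preimage_add_right, hker]

theorem volume_inner_eq_inner {b b' : RVec N} (h : b ≠ b') :
    volume {y : RVec N | inner ℝ b y = inner ℝ b' y} = 0 := by
  rw [← volume_inner_eq (sub_ne_zero.2 h) 0]
  simp only [inner_sub_left, sub_eq_zero]

/-- The pyramid with gradients in `S`. -/
noncomputable def pyramid {N : ℕ} (S : Finset (RVec N)) (hS : S.Nonempty) (y : RVec N) : ℝ :=
  S.inf' hS fun b => 1 + inner ℝ b y

theorem pyramid_le_add (S : Finset (RVec N)) (hS : S.Nonempty) (y z : RVec N) :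
    pyramid S hS y ≤ pyramid S hS z + (∑ b ∈ S, ‖b‖) * dist y z := by
  obtain ⟨b, hb, hbz⟩ := S.exists_mem_eq_inf' hS fun b => 1 + inner ℝ b z
  have h1 : pyramid S hS y ≤ 1 + inner ℝ b y := S.inf'_le _ hb
  have h2 : pyramid S hS z = 1 + inner ℝ b z := hbz
  have h3 : inner ℝ b y - inner ℝ b z ≤ ‖b‖ * dist y z := by
    rw [← inner_sub_right, dist_eq_norm]; exact real_inner_le_norm _ _
  have h4 : ‖b‖ * dist y z ≤ (∑ b ∈ S, ‖b‖) * dist y z :=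
    mul_le_mul_of_nonneg_right
      (Finset.single_le_sum (f := fun b => ‖b‖) (fun _ _ => norm_nonneg _) hb) dist_nonneg
  linarith

/-- If the pyramid with gradients in `S` is bounded, then the origin is a convex combination of the
elements of `S`, and `g` satisfies the corresponding convexity inequality. -/
theorem IsPiecewiseAffineQuasiconvex.exists_weights {g : RMat m N → ℝ≥0∞}
    (hg : IsPiecewiseAffineQuasiconvex g) (S : Finset (RVec N)) (hS : S.Nonempty)
    (hb : Bornology.IsBounded {y : RVec N | ∀ b ∈ S, 0 < 1 + inner ℝ b y}) (ξ : RMat m N)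
    (i : Fin m) :
    ∃ l : RVec N → ℝ, (∀ b, 0 ≤ l b) ∧ ∑ b ∈ S, l b = 1 ∧ (∀ j, ∑ b ∈ S, l b * b j = 0) ∧
      g ξ ≤ ∑ b ∈ S, ENNReal.ofReal (l b) * g (ξ + rowMat i b) := by
  set D : Set (RVec N) := {y | ∀ b ∈ S, 0 < 1 + inner ℝ b y} with hDdef
  have hDmem : ∀ y, y ∈ D ↔ 0 < pyramid S hS y := fun y => (Finset.lt_inf'_iff hS).symm
  have hcont : Continuous (pyramid S hS) :=
    (LipschitzWith.of_le_add_mul (Real.toNNReal (∑ b ∈ S, ‖b‖)) fun y z => by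
      rw [Real.coe_toNNReal _ (by positivity)]; exact pyramid_le_add S hS y z).continuous
  have hDo : IsOpen D := by
    have : D = pyramid S hS ⁻¹' Ioi 0 := by ext y; exact hDmem y
    rw [this]; exact isOpen_Ioi.preimage hcont
  have hDconv : Convex ℝ D := by
    intro y hy z hz a c ha hc hac b hbS
    have h1 := hy b hbS
    have h2 := hz b hbS
    rw [inner_add_right, inner_smul_right, inner_smul_right]
    have h3 : 1 + (a * inner ℝ b y + c * inner ℝ b z) =
        a * (1 + inner ℝ b y) + c * (1 + inner ℝ b z) := by
      linear_combination -hac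
    rw [h3]
    rcases ha.eq_or_lt with rfl | ha'
    · have : c = 1 := by linarith
      subst this; simpa using h2
    · exact add_pos_of_pos_of_nonneg (mul_pos ha' h1) (mul_nonneg hc h2.le)
  have hfr : volume (frontier D) = 0 := hDconv.addHaar_frontier _
  have h0D : (0 : RVec N) ∈ D := fun b _ => by simp
  have hDpos : volume D ≠ 0 := (hDo.measure_pos volume ⟨0, h0D⟩).ne'
  have hDtop : volume D ≠ ∞ := hb.measure_lt_top.ne
  let T : RVec N → RVec N →L[ℝ] RVec m := fun b =>
    (innerSL ℝ b).smulRight (EuclideanSpace.single i (1 : ℝ))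
  -- The domain `D` is exactly the set where the pyramid is positive, so its positive part is an
  -- admissible map on `D`, with gradients `rowMat i b`, `b ∈ S`.
  let u : RVec N → RVec m := fun y => max (pyramid S hS y) 0 • EuclideanSpace.single i (1 : ℝ)
  have hu : LipschitzWith (Real.toNNReal (∑ b ∈ S, ‖b‖)) u := by
    have h1 : LipschitzWith (Real.toNNReal (∑ b ∈ S, ‖b‖)) fun y => max (pyramid S hS y) 0 :=
      (LipschitzWith.of_le_add_mul _ fun y z => by
        rw [Real.coe_toNNReal _ (by positivity)]; exact pyramid_le_add S hS y z).max_const 0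
    refine LipschitzWith.of_dist_le_mul fun y z => ?_
    refine le_trans (le_of_eq ?_) (h1.dist_le_mul y z)
    simp only [u]
    rw [dist_eq_norm, ← sub_smul, norm_smul, PiLp.norm_single, norm_one, mul_one, ← dist_eq_norm]
  have hu0 : ∀ y ∉ D, u y = 0 := by
    intro y hy
    rw [hDmem, not_lt] at hy
    simp only [u, max_eq_right hy, zero_smul]
  -- Ties between two slopes fill finitely many hyperplanes. Away from them a single slope attains
  -- the minimum, and by continuity it does so in a neighbourhood.
  have hnull : ∀ᵐ y : RVec N, ∀ b ∈ S, ∀ b' ∈ S, b ≠ b' → inner ℝ b y ≠ inner ℝ b' y := by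
    refine (ae_ball_iff S.countable_toSet).2 fun b _ => ?_
    refine (ae_ball_iff S.countable_toSet).2 fun b' _ => ?_
    by_cases hbb : b = b'
    · exact Filter.Eventually.of_forall fun y h => absurd hbb h
    · filter_upwards [measure_eq_zero_iff_ae_notMem.1 (volume_inner_eq_inner hbb)] with y hy _
      exact hy
  have haff : ∀ᵐ y ∂volume.restrict D, ∃ b ∈ S, ∀ᶠ z in nhds y, u z = u y + T b (z - y) := by
    rw [ae_restrict_iff' hDo.measurableSet]
    filter_upwards [hnull] with y hy hyD
    obtain ⟨b, hbS, hby⟩ := S.exists_mem_eq_inf' hS fun b => 1 + inner ℝ b y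
    refine ⟨b, hbS, ?_⟩
    have hev : ∀ᶠ z in nhds y, ∀ b' ∈ S, b' ≠ b → inner ℝ b z < inner ℝ b' z := by
      refine (Filter.eventually_all_finset S).2 fun b' hb' => ?_
      by_cases hne : b' = b
      · exact Filter.Eventually.of_forall fun z h => absurd hne h
      · have h1 : 1 + inner ℝ b y ≤ 1 + inner ℝ b' y := hby ▸ S.inf'_le _ hb'
        have h2 : inner ℝ b y < inner ℝ b' y :=
          lt_of_le_of_ne (by linarith) (hy b hbS b' hb' (Ne.symm hne))
        have h3 : ContinuousAt (fun z : RVec N => inner ℝ b z) y := by fun_prop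
        have h4 : ContinuousAt (fun z : RVec N => inner ℝ b' z) y := by fun_prop
        filter_upwards [h3.eventually_lt h4 h2] with z hz _ using hz
    have hval : ∀ z, (∀ b' ∈ S, b' ≠ b → inner ℝ b z < inner ℝ b' z) → z ∈ D →
        u z = (1 + inner ℝ b z) • EuclideanSpace.single i (1 : ℝ) := by
      intro z hz hzD
      have h1 : pyramid S hS z = 1 + inner ℝ b z := by
        refine le_antisymm (S.inf'_le _ hbS) (Finset.le_inf' _ _ fun b' hb' => ?_)
        by_cases hne : b' = b
        · rw [hne]
        · linarith [hz b' hb' hne]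
      rw [← h1]
      simp only [u, max_eq_left ((hDmem z).1 hzD).le]
    have hself := hval y hev.self_of_nhds hyD
    filter_upwards [hev, hDo.mem_nhds hyD] with z hz hzD
    rw [hval z hz hzD, hself]
    simp only [T, ContinuousLinearMap.smulRight_apply, innerSL_apply_apply, inner_sub_right]
    rw [← add_smul]
    congr 1
    ring
  have hjac : ∀ᵐ y ∂volume.restrict D, ∃ b ∈ S, jac u y = rowMat i b := by
    filter_upwards [haff] with y ⟨b, hbS, h⟩
    exact ⟨b, hbS, by rw [jac_eq_linMat (hasFDerivAt_of_eventually_affine h), linMat_smulRight]⟩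
  let E : RVec N → Set (RVec N) := fun b => {y | jac u y = rowMat i b}
  have hE : ∀ b, MeasurableSet (E b) := fun b => measurable_jac u (measurableSet_singleton _)
  -- Almost everywhere in `D` exactly one indicator is active. The target is a general monoid
  -- because the formula serves both for `ℝ≥0∞`-valued `F` and for the real entries of the gradient.
  have hsum : ∀ {M : Type} [AddCommMonoid M] (F : RMat m N → M),
      ∀ᵐ y ∂volume.restrict D, F (jac u y) =
        ∑ b ∈ S, (E b).indicator (fun _ => F (rowMat i b)) y := by
    intro M _ F
    filter_upwards [hjac] with y ⟨b, hbS, hy⟩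
    rw [Finset.sum_eq_single_of_mem b hbS, indicator_of_mem (show y ∈ E b from hy), hy]
    intro b' _ hne
    refine indicator_of_notMem (fun h => hne (rowMat_injective i ?_)) _
    rw [← hy, ← show jac u y = rowMat i b' from h]
  have hlint : ∀ F : RMat m N → ℝ≥0∞, ∫⁻ y in D, F (jac u y) =
      ∑ b ∈ S, F (rowMat i b) * volume (E b ∩ D) := by
    intro F
    rw [lintegral_congr_ae (hsum F), lintegral_finsetSum _
      fun b _ => measurable_const.indicator (hE b)]
    refine Finset.sum_congr rfl fun b _ => ?_
    rw [lintegral_indicator_const (hE b), Measure.restrict_apply (hE b)]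
  have hfinE : ∀ b, volume (E b ∩ D) ≠ ∞ := fun b =>
    ne_top_of_le_ne_top hDtop (measure_mono inter_subset_right)
  have hDr : 0 < volume.real D := ENNReal.toReal_pos hDpos hDtop
  -- The weight of `b` is the fraction of `D` on which the gradient of the pyramid is `b`.
  refine ⟨fun b => volume.real (E b ∩ D) / volume.real D, fun b => by positivity, ?_, ?_, ?_⟩
  · have h1 := hlint fun _ => 1
    simp only [lintegral_const, Measure.restrict_apply_univ, one_mul] at h1
    rw [← Finset.sum_div, div_eq_one_iff_eq hDr.ne', measureReal_def, h1,
      ENNReal.toReal_sum fun b _ => hfinE b]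
    rfl
  · intro j
    have hcs : HasCompactSupport u := by
      refine HasCompactSupport.of_support_subset_isCompact hb.isCompact_closure ?_
      intro y hy
      by_contra h
      exact hy (hu0 y fun h' => h (subset_closure h'))
    -- The barycentre of the slopes is `0` because the gradient of a compactly supported Lipschitz
    -- map has mean zero.
    have h1 := integral_jac_eq_zero hu hcs i j
    have h2 : ∫ y in D, jac u y i j = ∫ y, jac u y i j := by
      rw [← integral_indicator hDo.measurableSet]
      refine integral_congr_ae ?_
      filter_upwards [measure_eq_zero_iff_ae_notMem.1 hfr] with y hyf
      by_cases hyD : y ∈ D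
      · rw [indicator_of_mem hyD]
      · rw [indicator_of_notMem hyD, jac_eq_zero_of_eventuallyEq_const (c := 0)]
        · rfl
        have hyc : y ∉ closure D := fun h => hyf (by rw [hDo.frontier_eq]; exact ⟨h, hyD⟩)
        filter_upwards [isClosed_closure.isOpen_compl.mem_nhds hyc] with z hz
        exact hu0 z fun h => hz (subset_closure h)
    rw [h1, integral_congr_ae (hsum fun A => A i j), integral_finsetSum] at h2
    · have h3 : ∀ b ∈ S, ∫ y in D, (E b).indicator (fun _ => rowMat i b i j) y =
          volume.real (E b ∩ D) * b j := by
        intro b _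
        rw [integral_indicator_const _ (hE b), measureReal_restrict_apply (hE b)]
        simp [rowMat]
      rw [Finset.sum_congr rfl h3] at h2
      simp only [div_mul_eq_mul_div]
      rw [← Finset.sum_div, h2, zero_div]
    · intro b _
      refine (integrable_indicator_iff (hE b)).2 (integrableOn_const ?_)
      rw [Measure.restrict_apply (hE b)]
      exact hfinE b
  · have h1 := hg ξ D hDo hb hfr u _ hu hu0 (T '' S) (S.finite_toSet.image T) (by
      filter_upwards [haff] with y ⟨b, hbS, h⟩
      exact ⟨T b, mem_image_of_mem T hbS, h⟩)
    rw [hlint fun A => g (ξ + A)] at h1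
    have h2 : g ξ ≤ (volume D)⁻¹ * ∑ b ∈ S, g (ξ + rowMat i b) * volume (E b ∩ D) := by
      rw [mul_comm, ← div_eq_mul_inv, ENNReal.le_div_iff_mul_le (Or.inl hDpos) (Or.inl hDtop),
        mul_comm]
      exact h1
    refine h2.trans (le_of_eq ?_)
    rw [Finset.mul_sum]
    refine Finset.sum_congr rfl fun b _ => ?_
    have h3 : ENNReal.ofReal (volume.real (E b ∩ D) / volume.real D) =
        volume (E b ∩ D) * (volume D)⁻¹ := by
      rw [ENNReal.ofReal_div_of_pos hDr, measureReal_def, measureReal_def,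
        ENNReal.ofReal_toReal (hfinE b), ENNReal.ofReal_toReal hDtop, div_eq_mul_inv]
    simp only [h3]
    ring

/-! ### Finite functions: local boundedness, local Lipschitz bounds, continuity -/

/-- The number `R` or `-R`, according to a boolean. -/
def signed (R : ℝ) (s : Bool) : ℝ := if s then R else -R

theorem abs_signed (R : ℝ) (s : Bool) : |signed R s| = |R| := by
  cases s <;> simp [signed]

theorem signed_decide_mul (R t : ℝ) : signed R (decide (t < 0)) * t = -(R * |t|) := by
  by_cases h : t < 0
  · simp [signed, h, abs_of_neg h]
  · simp [signed, h, abs_of_nonneg (not_lt.1 h)]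

theorem norm_le_sum_abs (y : RVec N) : ‖y‖ ≤ ∑ j, |y j| := by
  conv_lhs => rw [← EuclideanSpace.sum_smul_single y]
  refine (norm_sum_le _ _).trans (le_of_eq (Finset.sum_congr rfl fun j _ => ?_))
  rw [norm_smul]
  simp

theorem inner_eq_sum (b y : RVec N) : inner ℝ b y = ∑ j, b j * y j := by
  simp [PiLp.inner_apply, mul_comm]

theorem sum_ofReal_mul_le {ι : Type*} (S : Finset ι) {l : ι → ℝ} (hl : ∀ b, 0 ≤ l b)
    {a : ι → ℝ≥0∞} {M : ℝ≥0∞} (h : ∀ b ∈ S, a b ≤ M) :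
    ∑ b ∈ S, ENNReal.ofReal (l b) * a b ≤ ENNReal.ofReal (∑ b ∈ S, l b) * M := by
  rw [ENNReal.ofReal_sum_of_nonneg fun b _ => hl b, Finset.sum_mul]
  exact Finset.sum_le_sum fun b hb => mul_le_mul_right (h b hb) _

namespace IsPiecewiseAffineQuasiconvex

variable {g : RMat m N → ℝ≥0∞}

/-- The slopes lead from the `i`-th row of `ζ` to the vertices of the cube `[-R', R']^N`. That row
is interior to the cube, so the pyramid is bounded, and the resulting average of `g` is at most its
largest value at a vertex. -/
theorem exists_le_updateRow (hg : IsPiecewiseAffineQuasiconvex g) {R R' : ℝ} (hR : R < R')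
    {ζ : RMat m N} {i : Fin m} (hζ : ∀ j, |ζ i j| ≤ R) :
    ∃ τ : Fin N → Bool, g ζ ≤ g (ζ.updateRow i fun j => signed R' (τ j)) := by
  classical
  let b : (Fin N → Bool) → RVec N := fun τ => WithLp.toLp 2 fun j => signed R' (τ j) - ζ i j
  have hbj : ∀ τ j, b τ j = signed R' (τ j) - ζ i j := fun _ _ => rfl
  have hrow : ∀ τ, ζ + rowMat i (b τ) = ζ.updateRow i fun j => signed R' (τ j) := by
    intro τ
    ext i' j
    by_cases h : i' = i
    · subst h; simp [rowMat, hbj]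
    · simp [rowMat, h]
  have hbdd : Bornology.IsBounded
      {y : RVec N | ∀ c ∈ Finset.univ.image b, 0 < 1 + inner ℝ c y} := by
    refine (Metric.isBounded_closedBall (x := (0 : RVec N)) (r := 1 / (R' - R))).subset ?_
    intro y hy
    -- The vertex whose signs are opposite to those of `y` gives `⟨b, y⟩ ≤ -(R' - R) ∑ |y j|`.
    have h1 := hy (b fun j => decide (y j < 0)) (Finset.mem_image_of_mem _ (Finset.mem_univ _))
    rw [inner_eq_sum] at h1
    have h2 : ∑ j, b (fun j => decide (y j < 0)) j * y j ≤ ∑ j, -((R' - R) * |y j|) := by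
      refine Finset.sum_le_sum fun j _ => ?_
      rw [hbj, sub_mul, signed_decide_mul]
      have h3 : |ζ i j * y j| ≤ R * |y j| := by
        rw [abs_mul]; exact mul_le_mul_of_nonneg_right (hζ j) (abs_nonneg _)
      linarith [(abs_le.1 h3).1]
    rw [Finset.sum_neg_distrib, ← Finset.mul_sum] at h2
    rw [Metric.mem_closedBall, dist_zero_right]
    refine (norm_le_sum_abs y).trans ?_
    rw [le_div_iff₀ (by linarith)]
    linarith
  obtain ⟨l, hl0, hl1, -, hle⟩ := hg.exists_weights (Finset.univ.image b)
    (Finset.univ_nonempty.image b) hbdd ζ i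
  obtain ⟨τ, -, hτ⟩ := Finset.exists_max_image (Finset.univ : Finset (Fin N → Bool))
    (fun τ => g (ζ + rowMat i (b τ))) Finset.univ_nonempty
  refine ⟨τ, ?_⟩
  rw [← hrow]
  refine hle.trans ((sum_ofReal_mul_le _ hl0 (M := g (ζ + rowMat i (b τ))) ?_).trans ?_)
  · intro c hc
    obtain ⟨τ', -, rfl⟩ := Finset.mem_image.1 hc
    exact hτ τ' (Finset.mem_univ _)
  · rw [hl1, ENNReal.ofReal_one, one_mul]

/-- Replacing the rows one by one by rows with entries `±(R + 1)` never lowers `g` for a suitable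
choice of signs. In the end only finitely many sign matrices remain, and `g` is finite at each. -/
theorem exists_bound (hg : IsPiecewiseAffineQuasiconvex g) (hfin : ∀ ξ, g ξ ≠ ∞) (R : ℝ) :
    ∃ M : ℝ≥0∞, M ≠ ∞ ∧ ∀ ζ : RMat m N, (∀ i j, |ζ i j| ≤ R) → g ζ ≤ M := by
  classical
  refine ⟨Finset.univ.sup fun τ : Fin m → Fin N → Bool =>
    g (Matrix.of fun i j => signed (R + 1) (τ i j)), ?_, ?_⟩
  · rw [← lt_top_iff_ne_top, Finset.sup_lt_iff ENNReal.zero_lt_top]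
    exact fun τ _ => (hfin _).lt_top
  intro ζ hζ
  have key : ∀ s : Finset (Fin m), ∃ τ : Fin m → Fin N → Bool,
      g ζ ≤ g (Matrix.of fun i j => if i ∈ s then signed (R + 1) (τ i j) else ζ i j) := by
    intro s
    induction s using Finset.induction_on with
    | empty => exact ⟨fun _ _ => true, le_of_eq (by congr 1)⟩
    | insert i s his ih =>
      obtain ⟨τ, hτ⟩ := ih
      obtain ⟨σ, hσ⟩ := hg.exists_le_updateRow (lt_add_one R) (i := i)
        (ζ := Matrix.of fun i j => if i ∈ s then signed (R + 1) (τ i j) else ζ i j)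
        (fun j => by simpa [his] using hζ i j)
      refine ⟨Function.update τ i σ, hτ.trans (hσ.trans (le_of_eq ?_))⟩
      congr 1
      ext i' j
      by_cases h : i' = i
      · subst h; simp
      · simp [h]
  obtain ⟨τ, hτ⟩ := key Finset.univ
  simp only [Finset.mem_univ, if_true] at hτ
  exact hτ.trans (Finset.le_sup (f := fun τ : Fin m → Fin N → Bool =>
    g (Matrix.of fun i j => signed (R + 1) (τ i j))) (Finset.mem_univ τ))

/-- The pyramid has the small slope `e = δ eⱼ` and large slopes whose `j`-th component has the sign
opposite to `δ` and modulus at least `1`. As the barycentre is `0`, the large slopes have total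
weight at most `|δ|`; at them `g` is bounded by `M`, and the weight of `e` is at most `1`. -/
theorem le_add_single (hg : IsPiecewiseAffineQuasiconvex g) {ζ : RMat m N} {M : ℝ≥0∞}
    (hM : ∀ η : RMat m N, (∀ i j, |η i j - ζ i j| ≤ 3) → g η ≤ M) (i : Fin m) (j : Fin N)
    (δ : ℝ) : g ζ ≤ g (ζ + rowMat i (EuclideanSpace.single j δ)) + ENNReal.ofReal |δ| * M := by
  classical
  by_cases hδ : δ = 0
  · subst hδ
    have : ζ + rowMat i (EuclideanSpace.single j (0 : ℝ)) = ζ := by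
      ext i' j'; simp [rowMat]
    rw [this]
    exact le_self_add
  obtain ⟨s, hs, hsδ⟩ : ∃ s : ℝ, |s| = 1 ∧ s * δ = |δ| := by
    rcases lt_or_gt_of_ne hδ with h | h
    · exact ⟨-1, by simp, by rw [abs_of_neg h]; ring⟩
    · exact ⟨1, by simp, by rw [abs_of_pos h]; ring⟩
  have hss : s * s = 1 := by rw [← abs_mul_abs_self, hs, one_mul]
  have hδpos : 0 < |δ| := abs_pos.2 hδ
  -- These are the vertices of `[-1,1]^N` translated by `-2s eⱼ`, where `s` is the sign of `δ`:
  -- hence `s * b τ j ≤ 1 - 2 = -1`, and the entries are at most `1 + 2 = 3` in modulus.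
  let b : (Fin N → Bool) → RVec N := fun τ =>
    WithLp.toLp 2 fun k => signed 1 (τ k) - if k = j then 2 * s else 0
  have hbk : ∀ τ k, b τ k = signed 1 (τ k) - if k = j then 2 * s else 0 := fun _ _ => rfl
  have hsb : ∀ τ, s * b τ j ≤ -1 := by
    intro τ
    have h1 : |s * signed 1 (τ j)| ≤ 1 := by rw [abs_mul, abs_signed, hs]; simp
    rw [hbk, if_pos rfl]
    nlinarith [(abs_le.1 h1).2]
  have hbabs : ∀ τ k, |b τ k| ≤ 3 := by
    intro τ k
    have h1 : |signed 1 (τ k)| = 1 := by rw [abs_signed, abs_one]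
    rw [hbk]
    refine (abs_sub _ _).trans ?_
    split_ifs
    · rw [h1, abs_mul, hs]; norm_num
    · rw [h1]; norm_num
  set e : RVec N := EuclideanSpace.single j δ with he
  have hej : e j = δ := by simp [he]
  set S2 := Finset.univ.image b with hS2
  have heS : e ∉ S2 := by
    intro h
    obtain ⟨τ, -, hτ⟩ := Finset.mem_image.1 h
    have h1 := hsb τ
    rw [hτ, hej, hsδ] at h1
    linarith
  have hbdd : Bornology.IsBounded
      {y : RVec N | ∀ c ∈ insert e S2, 0 < 1 + inner ℝ c y} := by
    refine (Metric.isBounded_closedBall (x := (0 : RVec N)) (r := 1 + 2 / |δ|)).subset ?_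
    intro y hy
    have h1 := hy (b fun j => decide (y j < 0))
      (Finset.mem_insert_of_mem (Finset.mem_image_of_mem _ (Finset.mem_univ _)))
    have h2 := hy e (Finset.mem_insert_self _ _)
    have h3 : inner ℝ e y = δ * y j := by
      rw [he, EuclideanSpace.inner_single_left]; simp
    have h4 : inner ℝ (b fun j => decide (y j < 0)) y = -(∑ k, |y k|) - 2 * s * y j := by
      rw [inner_eq_sum]
      have : ∀ k, b (fun j => decide (y j < 0)) k * y k =
          -|y k| - if k = j then 2 * s * y k else 0 := by
        intro k
        rw [hbk, sub_mul, signed_decide_mul, one_mul, ite_mul, zero_mul]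
      simp only [this, Finset.sum_sub_distrib, Finset.sum_neg_distrib, Finset.sum_ite_eq',
        Finset.mem_univ, if_true]
    rw [h3] at h2
    rw [h4] at h1
    rw [Metric.mem_closedBall, dist_zero_right]
    refine (norm_le_sum_abs y).trans ?_
    have h5 : δ = s * |δ| := by rw [← hsδ, ← mul_assoc, hss, one_mul]
    -- The slope `e` bounds `s * y j` from below, and the opposite vertex gives `∑ |y k| < 1 - 2 s y
    -- j`. Together they yield the radius `1 + 2/|δ|`.
    have h6 : -(1 / |δ|) ≤ s * y j := by
      rw [neg_le, ← sub_nonneg]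
      have h7 : 0 < 1 + |δ| * (s * y j) := by
        have : δ * y j = |δ| * (s * y j) := by
          conv_lhs => rw [h5]
          ring
        linarith
      have h8 : 1 / |δ| - -(s * y j) = (1 + |δ| * (s * y j)) / |δ| := by
        field_simp
        ring
      rw [h8]; positivity
    have h9 : 2 / |δ| = 2 * (1 / |δ|) := by ring
    rw [h9]
    linarith
  obtain ⟨l, hl0, hl1, hlj, hle⟩ := hg.exists_weights (insert e S2)
    (Finset.insert_nonempty _ _) hbdd ζ i
  rw [Finset.sum_insert heS] at hl1 hle
  have hlj' := hlj j
  rw [Finset.sum_insert heS, hej] at hlj'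
  have hsum0 : 0 ≤ ∑ c ∈ S2, l c := Finset.sum_nonneg fun c _ => hl0 c
  have h1 : s * ∑ c ∈ S2, l c * c j ≤ -∑ c ∈ S2, l c := by
    rw [Finset.mul_sum, ← Finset.sum_neg_distrib]
    refine Finset.sum_le_sum fun c hc => ?_
    obtain ⟨τ, -, rfl⟩ := Finset.mem_image.1 hc
    nlinarith [hsb τ, hl0 (b τ)]
  -- The `j`-th component of the barycentre, multiplied by `s`, reads `l e * |δ| + s ∑ l c * c j =
  -- 0`.
  have h2 : ∑ c ∈ S2, l c ≤ |δ| := by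
    have h3 : s * (l e * δ) + s * ∑ c ∈ S2, l c * c j = 0 := by rw [← mul_add, hlj', mul_zero]
    have h4 : s * (l e * δ) = l e * |δ| := by rw [← hsδ]; ring
    have h5 : l e ≤ 1 := by linarith
    nlinarith
  refine hle.trans (add_le_add ?_ ?_)
  · refine (mul_le_mul_left (ENNReal.ofReal_le_one.2 (by linarith)) _).trans (le_of_eq (one_mul _))
  · refine (sum_ofReal_mul_le S2 hl0 (M := M) ?_).trans
      (mul_le_mul_left (ENNReal.ofReal_le_ofReal h2) _)
    intro c hc
    obtain ⟨τ, -, rfl⟩ := Finset.mem_image.1 hc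
    refine hM _ fun i' j' => ?_
    simp only [rowMat, Matrix.add_apply, Matrix.of_apply, add_sub_cancel_left]
    split_ifs
    · exact hbabs τ j'
    · norm_num

/-- Change `ζ` into `η` entry by entry. The intermediate matrices keep entries bounded by `R`, so a
bound of `g` for entries up to `R + 3` serves at every application of `le_add_single`. -/
theorem exists_lipschitz_bound (hg : IsPiecewiseAffineQuasiconvex g) (hfin : ∀ ξ, g ξ ≠ ∞)
    (R : ℝ) : ∃ M : ℝ≥0∞, M ≠ ∞ ∧ ∀ ζ η : RMat m N, (∀ i j, |ζ i j| ≤ R) →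
      (∀ i j, |η i j| ≤ R) →
      g ζ ≤ g η + ENNReal.ofReal (∑ p : Fin m × Fin N, |η p.1 p.2 - ζ p.1 p.2|) * M := by
  classical
  obtain ⟨M, hMt, hM⟩ := hg.exists_bound hfin (R + 3)
  refine ⟨M, hMt, fun ζ η hζ hη => ?_⟩
  have key : ∀ t : Finset (Fin m × Fin N),
      g ζ ≤ g (Matrix.of fun i j => if (i, j) ∈ t then η i j else ζ i j) +
        ENNReal.ofReal (∑ p ∈ t, |η p.1 p.2 - ζ p.1 p.2|) * M := by
    intro t
    induction t using Finset.induction_on with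
    | empty =>
      simp only [Finset.notMem_empty, if_false]
      exact le_self_add
    | insert p t hpt ih =>
      set θ : RMat m N := Matrix.of fun i j => if (i, j) ∈ t then η i j else ζ i j with hθ
      have hθR : ∀ i j, |θ i j| ≤ R := by
        intro i j
        simp only [hθ, Matrix.of_apply]
        split_ifs
        · exact hη i j
        · exact hζ i j
      have h1 := hg.le_add_single (ζ := θ) (M := M) (fun η' hη' => hM η' fun i j => by
        have := abs_add_le (η' i j - θ i j) (θ i j)
        rw [sub_add_cancel] at this
        linarith [hη' i j, hθR i j]) p.1 p.2 (η p.1 p.2 - ζ p.1 p.2)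
      have h2 : θ + rowMat p.1 (EuclideanSpace.single p.2 (η p.1 p.2 - ζ p.1 p.2)) =
          Matrix.of fun i j => if (i, j) ∈ insert p t then η i j else ζ i j := by
        ext i j
        obtain ⟨p1, p2⟩ := p
        simp only [hθ, rowMat, Matrix.add_apply, Matrix.of_apply, PiLp.single_apply,
          Finset.mem_insert, Prod.mk.injEq]
        by_cases hi : i = p1
        · by_cases hj : j = p2
          · subst hi hj; simp [hpt]
          · simp [hj]
        · simp [hi]
      rw [h2] at h1
      rw [Finset.sum_insert hpt, ENNReal.ofReal_add (abs_nonneg _)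
        (Finset.sum_nonneg fun _ _ => abs_nonneg _), add_mul, ← add_assoc]
      exact ih.trans (add_le_add_left h1 _)
  have h := key Finset.univ
  simp only [Finset.mem_univ, if_true] at h
  exact h

theorem continuous (hg : IsPiecewiseAffineQuasiconvex g) (hfin : ∀ ξ, g ξ ≠ ∞) :
    Continuous g := by
  refine continuous_iff_continuousAt.2 fun ζ => ?_
  obtain ⟨M, hMt, hM⟩ := hg.exists_lipschitz_bound hfin (∑ p : Fin m × Fin N, |ζ p.1 p.2| + 1)
  have hle : ∀ i j, |ζ i j| ≤ ∑ p : Fin m × Fin N, |ζ p.1 p.2| := fun i j =>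
    Finset.single_le_sum (f := fun p : Fin m × Fin N => |ζ p.1 p.2|) (fun _ _ => abs_nonneg _)
      (Finset.mem_univ (i, j))
  have hentry : ∀ i j, Continuous fun η : RMat m N => η i j := fun i j =>
    continuous_id.matrix_elem i j
  have hnear : ∀ᶠ η in nhds ζ, ∀ i j, |η i j| ≤ ∑ p : Fin m × Fin N, |ζ p.1 p.2| + 1 := by
    refine Filter.eventually_all.2 fun i => Filter.eventually_all.2 fun j => ?_
    have h1 : |ζ i j| < ∑ p : Fin m × Fin N, |ζ p.1 p.2| + 1 := by linarith [hle i j]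
    filter_upwards [((hentry i j).abs.tendsto ζ).eventually (gt_mem_nhds h1)] with η hη using hη.le
  have hd : Filter.Tendsto (fun η : RMat m N => ENNReal.ofReal
      (∑ p : Fin m × Fin N, |η p.1 p.2 - ζ p.1 p.2|) * M) (nhds ζ) (nhds 0) := by
    have h1 : Continuous fun η : RMat m N => ∑ p : Fin m × Fin N, |η p.1 p.2 - ζ p.1 p.2| :=
      continuous_finsetSum _ fun p _ => ((hentry p.1 p.2).sub continuous_const).abs
    have h2 := ENNReal.tendsto_ofReal (h1.tendsto ζ)
    have h3 := ENNReal.Tendsto.mul_const h2 (Or.inr hMt)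
    simpa using h3
  refine tendsto_of_tendsto_of_tendsto_of_le_of_le'
    (g := fun η => g ζ - ENNReal.ofReal (∑ p : Fin m × Fin N, |η p.1 p.2 - ζ p.1 p.2|) * M)
    (h := fun η => g ζ + ENNReal.ofReal (∑ p : Fin m × Fin N, |η p.1 p.2 - ζ p.1 p.2|) * M)
    ?_ ?_ ?_ ?_
  · simpa using ENNReal.Tendsto.sub (tendsto_const_nhds (x := g ζ)) hd (Or.inl (hfin ζ))
  · simpa using (tendsto_const_nhds (x := g ζ)).add hd
  · filter_upwards [hnear] with η hη
    exact tsub_le_iff_right.2 (hM ζ η (fun i j => (hle i j).trans (by linarith)) hη)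
  · filter_upwards [hnear] with η hη
    have h1 := hM η ζ hη fun i j => (hle i j).trans (by linarith)
    simpa only [abs_sub_comm] using h1

end IsPiecewiseAffineQuasiconvex

/-! ### Kuhn interpolation on a lattice -/

theorem integrableOn_floor_add (a : ℝ) :
    IntegrableOn (fun s : ℝ => (⌊a + s⌋ : ℝ)) (Ico 0 1) := by
  have hm : Measurable fun s : ℝ => (⌊a + s⌋ : ℝ) :=
    (measurable_from_top (f := fun n : ℤ => (n : ℝ))).comp
      (Int.measurable_floor.comp (measurable_const.add measurable_id))
  refine Measure.integrableOn_of_bounded (M := |a| + 2) (by simp) hm.aestronglyMeasurable ?_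
  refine (ae_restrict_iff' measurableSet_Ico).2 (Filter.Eventually.of_forall fun s hs => ?_)
  have h1 := Int.floor_le (a + s)
  have h2 := Int.lt_floor_add_one (a + s)
  rw [Real.norm_eq_abs, abs_le]
  constructor <;> linarith [hs.1, hs.2, neg_abs_le a, le_abs_self a]

/-- Over `[a, a + 1]` the identity has mean `a + 1/2` and the fractional part, by periodicity, has
mean `1/2`. Averaging over the shift thus undoes the rounding, which makes the interpolation below
exact on affine data. -/
theorem integral_floor_add (a : ℝ) : ∫ s in Ico (0 : ℝ) 1, (⌊a + s⌋ : ℝ) = a := by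
  rw [integral_Ico_eq_integral_Ioc, ← intervalIntegral.integral_of_le zero_le_one,
    intervalIntegral.integral_comp_add_left (fun t : ℝ => (⌊t⌋ : ℝ)) a]
  have hper : Function.Periodic (Int.fract : ℝ → ℝ) 1 := fun x => Int.fract_add_one x
  have h1 : ∫ t in a..a + 1, Int.fract t = 1 / 2 := by
    rw [hper.intervalIntegral_add_eq a 0, zero_add, intervalIntegral.integral_of_le zero_le_one,
      ← integral_Ico_eq_integral_Ioc,
      setIntegral_congr_fun (g := fun t => t) measurableSet_Ico fun t ht =>
        Int.fract_eq_self.2 ⟨ht.1, ht.2⟩,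
      integral_Ico_eq_integral_Ioc, ← intervalIntegral.integral_of_le zero_le_one]
    simp
  have hfl : ∀ t : ℝ, (⌊t⌋ : ℝ) = t - Int.fract t := fun t => (Int.self_sub_fract t).symm
  simp only [hfl, add_zero]
  have hint : IntervalIntegrable (Int.fract : ℝ → ℝ) volume a (a + 1) := by
    rw [intervalIntegrable_iff]
    refine Measure.integrableOn_of_bounded (M := 1) (by simp) measurable_fract.aestronglyMeasurable
      (Filter.Eventually.of_forall fun t => ?_)
    rw [Real.norm_eq_abs, abs_of_nonneg (Int.fract_nonneg t)]
    exact (Int.fract_lt_one t).le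
  rw [intervalIntegral.integral_sub (by simp) hint, h1, integral_id]
  ring

theorem integral_abs_floor_sub (a b : ℝ) :
    ∫ s in Ico (0 : ℝ) 1, |(⌊a + s⌋ : ℝ) - ⌊b + s⌋| = |a - b| := by
  wlog h : b ≤ a generalizing a b
  · simp only [abs_sub_comm (⌊a + _⌋ : ℝ), abs_sub_comm a]
    exact this b a (le_of_not_ge h)
  have h1 : ∀ s : ℝ, |(⌊a + s⌋ : ℝ) - ⌊b + s⌋| = (⌊a + s⌋ : ℝ) - ⌊b + s⌋ := fun s =>
    abs_of_nonneg (sub_nonneg.2 (by exact_mod_cast Int.floor_mono (by linarith)))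
  simp only [h1]
  rw [integral_sub (integrableOn_floor_add a) (integrableOn_floor_add b), integral_floor_add,
    integral_floor_add, abs_of_nonneg (sub_nonneg.2 h)]

/-- The piecewise affine interpolation of a function on the lattice `ℤᴺ`. -/
noncomputable def latticeInterp {m N : ℕ} (p : (Fin N → ℤ) → RVec m) (y : RVec N) : RVec m :=
  ∫ s in Ico (0 : ℝ) 1, p fun i => ⌊y i + s⌋

theorem integrableOn_comp_floor {p : (Fin N → ℤ) → RVec m} {C : ℝ} (hp : ∀ k, ‖p k‖ ≤ C)
    (y : RVec N) : IntegrableOn (fun s : ℝ => p fun i => ⌊y i + s⌋) (Ico 0 1) := by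
  have hm : Measurable fun s : ℝ => p fun i => ⌊y i + s⌋ :=
    (Measurable.of_discrete (f := p)).comp (measurable_pi_lambda _ fun i =>
      Int.measurable_floor.comp (measurable_const.add measurable_id))
  exact Measure.integrableOn_of_bounded (M := C) (by simp) hm.aestronglyMeasurable
    (Filter.Eventually.of_forall fun s => hp _)

/-- The ℓ¹ Lipschitz bound on the lattice is averaged over the shift. It keeps its constant because
floors are monotone, so `|⌊a + s⌋ - ⌊b + s⌋|` has mean exactly `|a - b|`. -/
theorem norm_latticeInterp_sub_le {p : (Fin N → ℤ) → RVec m} {C : ℝ} (hp : ∀ k, ‖p k‖ ≤ C)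
    {K : ℝ} (hK : ∀ k k', ‖p k - p k'‖ ≤ K * ∑ i, |(k i : ℝ) - k' i|) (y z : RVec N) :
    ‖latticeInterp p y - latticeInterp p z‖ ≤ K * ∑ i, |y i - z i| := by
  rw [latticeInterp, latticeInterp, ← integral_sub (integrableOn_comp_floor hp y)
    (integrableOn_comp_floor hp z)]
  have hi : ∀ i, IntegrableOn (fun s : ℝ => |(⌊y i + s⌋ : ℝ) - ⌊z i + s⌋|) (Ico 0 1) := fun i =>
    ((integrableOn_floor_add (y i)).sub (integrableOn_floor_add (z i))).abs
  refine (norm_integral_le_of_norm_le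
    (g := fun s => K * ∑ i, |(⌊y i + s⌋ : ℝ) - ⌊z i + s⌋|)
    ((integrable_finsetSum _ fun i _ => hi i).const_mul K)
    (Filter.Eventually.of_forall fun s => hK _ _)).trans (le_of_eq ?_)
  rw [integral_const_mul, integral_finsetSum _ fun i _ => hi i]
  simp only [integral_abs_floor_sub]

/-- The vertex at which the diagonal line through `y` enters its `j`-th new lattice slab. -/
noncomputable def kuhnVertex {N : ℕ} (y : RVec N) (j : Fin N) : Fin N → ℤ :=
  fun i => ⌊y j⌋ + 1 + ⌊y i - y j⌋

/-- The increments of a lattice function along the edges of the simplex that contains `y`. -/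
noncomputable def kuhnSlope {m N : ℕ} (p : (Fin N → ℤ) → RVec m) (y : RVec N) (j : Fin N) :
    RVec m :=
  p (kuhnVertex y j) - p (kuhnVertex y j - Pi.single j 1)

theorem floor_add_of_near {y z : RVec N} {ε : ℝ} (hε : 0 < ε)
    (h1 : ∀ i, ε < Int.fract (y i) ∧ ε < 1 - Int.fract (y i))
    (h2 : ∀ i j, i ≠ j → ε < Int.fract (y i - y j) ∧ ε < 1 - Int.fract (y i - y j))
    (hz : ∀ i, |z i - y i| < ε / 2) {s : ℝ} (hs : s ∈ Ico (0 : ℝ) 1) {j : Fin N} {n : ℤ}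
    (hn : |y j + s - n| ≤ ε / 2) :
    n = ⌊y j⌋ + 1 ∧ ∀ i, i ≠ j → ⌊y i + s⌋ = kuhnVertex y j i ∧ ⌊z i + s⌋ = kuhnVertex y j i := by
  have a1 := Int.floor_add_fract (y j)
  have a2 := h1 j
  have a3 := abs_le.1 hn
  have hn1 : n = ⌊y j⌋ + 1 := by
    have b1 : (⌊y j⌋ : ℝ) < n := by linarith [hs.1, hs.2]
    have b2 : (n : ℝ) < ⌊y j⌋ + 2 := by linarith [hs.1, hs.2]
    have b1' : ⌊y j⌋ < n := by exact_mod_cast b1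
    have b2' : n < ⌊y j⌋ + 2 := by exact_mod_cast b2
    omega
  refine ⟨hn1, fun i hij => ?_⟩
  have c1 := Int.floor_add_fract (y i - y j)
  have c2 := h2 i j hij
  have c3 := abs_lt.1 (hz i)
  have hn2 : (n : ℝ) = ⌊y j⌋ + 1 := by exact_mod_cast hn1
  constructor <;> rw [Int.floor_eq_iff, kuhnVertex] <;> push_cast <;>
    constructor <;> linarith

/-- For each shift `s` at most one floor differs between `y` and `z`, and then by one. The lattice
point moves along an edge in direction `j` whose end points depend on `y` and `j` but not on `s` or
`z`. -/
theorem comp_floor_sub {p : (Fin N → ℤ) → RVec m} {y z : RVec N} {ε : ℝ} (hε : 0 < ε)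
    (h1 : ∀ i, ε < Int.fract (y i) ∧ ε < 1 - Int.fract (y i))
    (h2 : ∀ i j, i ≠ j → ε < Int.fract (y i - y j) ∧ ε < 1 - Int.fract (y i - y j))
    (hz : ∀ i, |z i - y i| < ε / 2) {s : ℝ} (hs : s ∈ Ico (0 : ℝ) 1) :
    (p fun i => ⌊z i + s⌋) - (p fun i => ⌊y i + s⌋) =
      ∑ j, ((⌊z j + s⌋ : ℝ) - ⌊y j + s⌋) • kuhnSlope p y j := by
  by_cases hall : ∀ j, ⌊z j + s⌋ = ⌊y j + s⌋
  · simp [hall]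
  push Not at hall
  obtain ⟨j, hj⟩ := hall
  have hε1 : ε < 1 := by
    have := h1 j
    linarith [Int.fract_nonneg (y j)]
  have hzj := abs_lt.1 (hz j)
  have f1 := Int.floor_le (z j + s)
  have f2 := Int.lt_floor_add_one (z j + s)
  have f3 := Int.floor_le (y j + s)
  have f4 := Int.lt_floor_add_one (y j + s)
  have hkj : kuhnVertex y j j = ⌊y j⌋ + 1 := by simp [kuhnVertex]
  have hcase : ∃ n : ℤ, |y j + s - n| ≤ ε / 2 ∧
      ((⌊z j + s⌋ = n ∧ ⌊y j + s⌋ = n - 1) ∨ (⌊z j + s⌋ = n - 1 ∧ ⌊y j + s⌋ = n)) := by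
    rcases lt_or_gt_of_ne hj with h | h
    · have g1 : (⌊z j + s⌋ : ℝ) + 1 ≤ ⌊y j + s⌋ := by exact_mod_cast h
      have g2 : (⌊y j + s⌋ : ℝ) < ⌊z j + s⌋ + 2 := by linarith
      have g3 : ⌊y j + s⌋ < ⌊z j + s⌋ + 2 := by exact_mod_cast g2
      refine ⟨⌊y j + s⌋, ?_, Or.inr ⟨by omega, rfl⟩⟩
      rw [abs_le]; constructor <;> linarith
    · have g1 : (⌊y j + s⌋ : ℝ) + 1 ≤ ⌊z j + s⌋ := by exact_mod_cast h
      have g2 : (⌊z j + s⌋ : ℝ) < ⌊y j + s⌋ + 2 := by linarith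
      have g3 : ⌊z j + s⌋ < ⌊y j + s⌋ + 2 := by exact_mod_cast g2
      refine ⟨⌊z j + s⌋, ?_, Or.inl ⟨rfl, by omega⟩⟩
      rw [abs_le]; constructor <;> linarith
  obtain ⟨n, hn, hfl⟩ := hcase
  obtain ⟨hn1, hoth⟩ := floor_add_of_near hε h1 h2 hz hs hn
  rw [Finset.sum_eq_single_of_mem j (Finset.mem_univ j) fun i _ hij => by
    rw [(hoth i hij).1, (hoth i hij).2, sub_self, zero_smul]]
  have hup : ∀ w : RVec N, (∀ i, i ≠ j → ⌊w i + s⌋ = kuhnVertex y j i) → ⌊w j + s⌋ = n →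
      (fun i => ⌊w i + s⌋) = kuhnVertex y j := by
    intro w hw hwj
    funext i
    by_cases hij : i = j
    · subst hij; rw [hwj, hkj, hn1]
    · exact hw i hij
  have hdown : ∀ w : RVec N, (∀ i, i ≠ j → ⌊w i + s⌋ = kuhnVertex y j i) →
      ⌊w j + s⌋ = n - 1 → (fun i => ⌊w i + s⌋) = kuhnVertex y j - Pi.single j 1 := by
    intro w hw hwj
    funext i
    by_cases hij : i = j
    · subst hij; rw [hwj, Pi.sub_apply, hkj, hn1, Pi.single_eq_same]
    · rw [hw i hij, Pi.sub_apply, Pi.single_eq_of_ne hij, sub_zero]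
  rcases hfl with ⟨hz1, hy1⟩ | ⟨hz1, hy1⟩
  · rw [hup z (fun i hij => (hoth i hij).2) hz1, hdown y (fun i hij => (hoth i hij).1) hy1, hz1,
      hy1]
    push_cast
    rw [sub_sub_cancel, one_smul]
    rfl
  · rw [hdown z (fun i hij => (hoth i hij).2) hz1, hup y (fun i hij => (hoth i hij).1) hy1, hz1,
      hy1]
    push_cast
    rw [sub_sub_cancel_left, neg_smul, one_smul, kuhnSlope, neg_sub]

/-- Integrate `comp_floor_sub` over `s`; the floor differences average to `z j - y j`. The excluded
points lie on the hyperplanes `y i ∈ ℤ` and `y i - y j ∈ ℤ` that bound the Kuhn simplices. -/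
theorem latticeInterp_eventually_affine {p : (Fin N → ℤ) → RVec m} {C : ℝ} (hp : ∀ k, ‖p k‖ ≤ C)
    {y : RVec N} (h1 : ∀ i, Int.fract (y i) ≠ 0)
    (h2 : ∀ i j, i ≠ j → Int.fract (y i - y j) ≠ 0) :
    ∀ᶠ z in nhds y, latticeInterp p z =
      latticeInterp p y + ∑ j, (z j - y j) • kuhnSlope p y j := by
  have hev : ∀ a : ℝ, Int.fract a ≠ 0 →
      ∀ᶠ ε in nhdsWithin (0 : ℝ) (Ioi 0), ε < Int.fract a ∧ ε < 1 - Int.fract a := by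
    intro a ha
    have ha0 : 0 < Int.fract a := lt_of_le_of_ne (Int.fract_nonneg a) (Ne.symm ha)
    have ha1 : 0 < 1 - Int.fract a := sub_pos.2 (Int.fract_lt_one a)
    exact ((gt_mem_nhds ha0).and (gt_mem_nhds ha1)).filter_mono nhdsWithin_le_nhds
  have hex : ∀ᶠ ε in nhdsWithin (0 : ℝ) (Ioi 0), 0 < ε ∧
      (∀ i, ε < Int.fract (y i) ∧ ε < 1 - Int.fract (y i)) ∧
      ∀ i j, i ≠ j → ε < Int.fract (y i - y j) ∧ ε < 1 - Int.fract (y i - y j) := by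
    have hpos : ∀ᶠ ε in nhdsWithin (0 : ℝ) (Ioi 0), 0 < ε := self_mem_nhdsWithin
    refine hpos.and (Filter.Eventually.and ?_ ?_)
    · exact Filter.eventually_all.2 fun i => hev _ (h1 i)
    · refine Filter.eventually_all.2 fun i => Filter.eventually_all.2 fun j => ?_
      by_cases hij : i = j
      · exact Filter.Eventually.of_forall fun ε h => absurd hij h
      · filter_upwards [hev _ (h2 i j hij)] with ε hε _ using hε
  obtain ⟨ε, hε, e1, e2⟩ := hex.exists
  have hnear : ∀ᶠ z in nhds y, ∀ i, |z i - y i| < ε / 2 := by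
    refine Filter.eventually_all.2 fun i => ?_
    have h3 : Continuous fun z : RVec N => |z i - y i| :=
      ((continuous_coord i).sub continuous_const).abs
    exact (h3.tendsto y).eventually (gt_mem_nhds (by simpa using hε))
  filter_upwards [hnear] with z hz
  rw [← sub_eq_iff_eq_add', latticeInterp, latticeInterp,
    ← integral_sub (integrableOn_comp_floor hp z) (integrableOn_comp_floor hp y),
    setIntegral_congr_fun measurableSet_Ico fun s hs => comp_floor_sub (p := p) hε e1 e2 hz hs]
  have hi : ∀ j, IntegrableOn (fun s : ℝ => (⌊z j + s⌋ : ℝ) - ⌊y j + s⌋) (Ico 0 1) := fun j =>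
    (integrableOn_floor_add _).sub (integrableOn_floor_add _)
  rw [integral_finsetSum _ fun j _ => (hi j).smul_const _]
  refine Finset.sum_congr rfl fun j _ => ?_
  rw [integral_smul_const, integral_sub (integrableOn_floor_add _) (integrableOn_floor_add _),
    integral_floor_add, integral_floor_add]

theorem ae_fract_ne_zero {h : ℝ} (hh : h ≠ 0) : ∀ᵐ y : RVec N,
    (∀ i, Int.fract ((h⁻¹ • y) i) ≠ 0) ∧
      ∀ i j, i ≠ j → Int.fract ((h⁻¹ • y) i - (h⁻¹ • y) j) ≠ 0 := by
  have key : ∀ b : RVec N, b ≠ 0 → ∀ᵐ y : RVec N, Int.fract (h⁻¹ * inner ℝ b y) ≠ 0 := by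
    intro b hb
    have h1 : ∀ᵐ y : RVec N, ∀ n : ℤ, inner ℝ b y ≠ h * n :=
      ae_all_iff.2 fun n => measure_eq_zero_iff_ae_notMem.1 (volume_inner_eq hb _)
    filter_upwards [h1] with y hy h0
    refine hy ⌊h⁻¹ * inner ℝ b y⌋ ?_
    have h2 := Int.floor_add_fract (h⁻¹ * inner ℝ b y)
    rw [h0, add_zero] at h2
    rw [h2, mul_inv_cancel_left₀ hh]
  have hs : ∀ (i : Fin N) (y : RVec N), inner ℝ (EuclideanSpace.single i (1 : ℝ)) y = y i :=
    fun i y => by rw [EuclideanSpace.inner_single_left]; simp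
  have k1 : ∀ᵐ y : RVec N, ∀ i, Int.fract ((h⁻¹ • y) i) ≠ 0 := by
    refine ae_all_iff.2 fun i => ?_
    filter_upwards [key (EuclideanSpace.single i 1) (by simp)] with y hy
    rwa [hs] at hy
  have k2 : ∀ᵐ y : RVec N, ∀ i j, i ≠ j → Int.fract ((h⁻¹ • y) i - (h⁻¹ • y) j) ≠ 0 := by
    refine ae_all_iff.2 fun i => ae_all_iff.2 fun j => ?_
    by_cases hij : i = j
    · exact Filter.Eventually.of_forall fun y h => absurd hij h
    · have hne : EuclideanSpace.single i (1 : ℝ) - EuclideanSpace.single j 1 ≠ (0 : RVec N) := by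
        intro h0
        have := congrArg (fun v : RVec N => v i) h0
        simp [hij] at this
      filter_upwards [key _ hne] with y hy _
      rw [inner_sub_left, hs, hs, mul_sub] at hy
      exact hy
  exact k1.and k2

/-- The restriction of `φ` to the lattice `hℤᴺ`. -/
noncomputable def latticeSample {m N : ℕ} (φ : RVec N → RVec m) (h : ℝ) (k : Fin N → ℤ) : RVec m :=
  φ (WithLp.toLp 2 fun i => h * k i)

/-- The piecewise affine interpolation of `φ` on the lattice `hℤᴺ`. -/
noncomputable def kuhnInterp {m N : ℕ} (φ : RVec N → RVec m) (h : ℝ) (y : RVec N) : RVec m :=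
  latticeInterp (latticeSample φ h) (h⁻¹ • y)

theorem norm_latticeSample_sub_le {φ : RVec N → RVec m} {L : NNReal} (hφ : LipschitzWith L φ)
    {h : ℝ} (hh : 0 < h) (k k' : Fin N → ℤ) :
    ‖latticeSample φ h k - latticeSample φ h k'‖ ≤ (L * h) * ∑ i, |(k i : ℝ) - k' i| := by
  refine (hφ.norm_sub_le _ _).trans ?_
  rw [mul_assoc]
  refine mul_le_mul_of_nonneg_left ((norm_le_sum_abs _).trans (le_of_eq ?_)) L.coe_nonneg
  rw [Finset.mul_sum]
  refine Finset.sum_congr rfl fun i _ => ?_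
  simp only [PiLp.sub_apply]
  rw [← mul_sub, abs_mul, abs_of_pos hh]

theorem sum_abs_le_mul_norm (y : RVec N) : ∑ j, |y j| ≤ N * ‖y‖ := by
  refine (Finset.sum_le_sum fun j _ => PiLp.norm_apply_le y j).trans ?_
  simp

theorem lipschitzWith_kuhnInterp {φ : RVec N → RVec m} {L : NNReal} (hφ : LipschitzWith L φ)
    {C : ℝ} (hC : ∀ y, ‖φ y‖ ≤ C) {h : ℝ} (hh : 0 < h) :
    LipschitzWith (L * N) (kuhnInterp φ h) := by
  refine LipschitzWith.of_dist_le_mul fun y z => ?_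
  rw [dist_eq_norm, dist_eq_norm]
  refine (norm_latticeInterp_sub_le (fun k => hC _) (norm_latticeSample_sub_le hφ hh) _ _).trans ?_
  have h1 : ∑ i, |(h⁻¹ • y) i - (h⁻¹ • z) i| = h⁻¹ * ∑ i, |(y - z) i| := by
    rw [Finset.mul_sum]
    refine Finset.sum_congr rfl fun i _ => ?_
    simp only [PiLp.smul_apply, PiLp.sub_apply, smul_eq_mul]
    rw [← mul_sub, abs_mul, abs_of_pos (inv_pos.2 hh)]
  rw [h1]
  push_cast
  calc (L * h) * (h⁻¹ * ∑ i, |(y - z) i|) = L * ∑ i, |(y - z) i| := by field_simp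
    _ ≤ L * (N * ‖y - z‖) := mul_le_mul_of_nonneg_left (sum_abs_le_mul_norm _) L.coe_nonneg
    _ = L * N * ‖y - z‖ := by ring

/-- The value at `y` only averages samples at lattice points within `h` of `y` in each coordinate,
hence within `N * h` in norm. -/
theorem kuhnInterp_eq_zero {φ : RVec N → RVec m} {D : Set (RVec N)} (h0 : ∀ y ∉ D, φ y = 0)
    {h : ℝ} (hh : 0 < h) {y : RVec N} (hy : y ∉ Metric.cthickening (N * h) D) :
    kuhnInterp φ h y = 0 := by
  rw [kuhnInterp, latticeInterp]
  refine integral_eq_zero_of_ae ((ae_restrict_iff' measurableSet_Ico).2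
    (Filter.Eventually.of_forall fun s hs => ?_))
  refine h0 _ fun hD => hy (Metric.mem_cthickening_of_dist_le _ _ _ _ hD ?_)
  rw [dist_eq_norm]
  refine (norm_le_sum_abs _).trans ?_
  have h1 : ∀ i, |(y - WithLp.toLp 2 fun i => h * (⌊(h⁻¹ • y) i + s⌋ : ℝ)) i| ≤ h := by
    intro i
    have f1 := Int.floor_le ((h⁻¹ • y) i + s)
    have f2 := Int.lt_floor_add_one ((h⁻¹ • y) i + s)
    have f3 : y i = h * (h⁻¹ • y) i := by
      simp only [PiLp.smul_apply, smul_eq_mul]; rw [mul_inv_cancel_left₀ hh.ne']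
    simp only [PiLp.sub_apply]
    rw [f3, ← mul_sub, abs_mul, abs_of_pos hh]
    refine mul_le_of_le_one_right hh.le ?_
    rw [abs_le]
    constructor <;> linarith [hs.1, hs.2]
  refine (Finset.sum_le_sum fun i _ => h1 i).trans ?_
  simp

/-- The linear map with the columns `d`. -/
noncomputable def ofColumns {m N : ℕ} (d : Fin N → RVec m) : RVec N →L[ℝ] RVec m :=
  ∑ j, (EuclideanSpace.proj (𝕜 := ℝ) j : RVec N →L[ℝ] ℝ).smulRight (d j)

theorem ofColumns_apply (d : Fin N → RVec m) (v : RVec N) :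
    ofColumns d v = ∑ j, v j • d j := by
  simp [ofColumns]

theorem linMat_ofColumns (d : Fin N → RVec m) (i : Fin m) (j : Fin N) :
    linMat (ofColumns d) i j = d j i := by
  rw [linMat, Matrix.of_apply, ofColumns_apply, Finset.sum_eq_single_of_mem j (Finset.mem_univ j)]
  · simp
  · intro k _ hk
    simp [hk]

theorem ae_kuhnInterp_eventually_affine {φ : RVec N → RVec m} {C : ℝ} (hC : ∀ y, ‖φ y‖ ≤ C)
    {h : ℝ} (hh : 0 < h) : ∀ᵐ y : RVec N, ∀ᶠ z in nhds y, kuhnInterp φ h z = kuhnInterp φ h y +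
      ofColumns (fun j => h⁻¹ • kuhnSlope (latticeSample φ h) (h⁻¹ • y) j) (z - y) := by
  filter_upwards [ae_fract_ne_zero (N := N) hh.ne'] with y hy
  have h1 := latticeInterp_eventually_affine (p := latticeSample φ h) (fun k => hC _) hy.1 hy.2
  have h2 : Filter.Tendsto (fun z : RVec N => h⁻¹ • z) (nhds y) (nhds (h⁻¹ • y)) :=
    (continuous_const_smul h⁻¹).tendsto y
  filter_upwards [h2.eventually h1] with z hz
  rw [kuhnInterp, hz, kuhnInterp, ofColumns_apply]
  congr 1
  refine Finset.sum_congr rfl fun j _ => ?_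
  rw [smul_smul]
  congr 1
  simp only [PiLp.smul_apply, PiLp.sub_apply, smul_eq_mul]
  ring

/-- Only finitely many lattice points meet the bounded set `D`. Hence the interpolant has finitely
many gradients, as the piecewise affine inequality demands. -/
theorem finite_range_latticeSample {φ : RVec N → RVec m} {D : Set (RVec N)}
    (hD : Bornology.IsBounded D) (h0 : ∀ y ∉ D, φ y = 0) {h : ℝ} (hh : 0 < h) :
    (range (latticeSample φ h)).Finite := by
  obtain ⟨R, hR⟩ := hD.subset_closedBall 0
  refine (((Set.finite_Icc (fun _ : Fin N => -⌈R / h⌉) fun _ => ⌈R / h⌉).image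
    (latticeSample φ h)).insert 0).subset ?_
  rintro _ ⟨k, rfl⟩
  by_cases hk : (WithLp.toLp 2 fun i => h * (k i : ℝ) : RVec N) ∈ D
  · refine mem_insert_of_mem _ (mem_image_of_mem _ ?_)
    have h1 : ∀ i, |(k i : ℝ)| ≤ ⌈R / h⌉ := by
      intro i
      have h2 : |h * (k i : ℝ)| ≤ R :=
        (PiLp.norm_apply_le (WithLp.toLp 2 fun i => h * (k i : ℝ) : RVec N) i).trans
          (by simpa using hR hk)
      rw [abs_mul, abs_of_pos hh, ← le_div_iff₀' hh] at h2
      exact h2.trans (Int.le_ceil _)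
    refine ⟨fun i => ?_, fun i => ?_⟩
    · have := (abs_le.1 (h1 i)).1
      exact_mod_cast this
    · have := (abs_le.1 (h1 i)).2
      exact_mod_cast this
  · exact Or.inl (h0 _ hk)

/-! ### Convergence of the interpolated gradients -/

/-- Difference quotients along points that converge at a controlled rate. -/
theorem HasFDerivAt.tendsto_inv_smul_sub {φ : RVec N → RVec m} {T : RVec N →L[ℝ] RVec m}
    {y v : RVec N} (hφ : HasFDerivAt φ T y) {h : ℕ → ℝ} (hpos : ∀ n, 0 < h n)
    (hlim : Filter.Tendsto h Filter.atTop (nhds 0)) {w w' : ℕ → RVec N} {K : ℝ}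
    (hw : ∀ n, ‖w n - y‖ ≤ K * h n) (hw' : ∀ n, ‖w' n - y‖ ≤ K * h n)
    (hv : ∀ n, w n - w' n = h n • v) :
    Filter.Tendsto (fun n => (h n)⁻¹ • (φ (w n) - φ (w' n))) Filter.atTop (nhds (T v)) := by
  have hone : ∀ w : ℕ → RVec N, (∀ n, ‖w n - y‖ ≤ K * h n) →
      (fun n => φ (w n) - φ y - T (w n - y)) =o[Filter.atTop] h := by
    intro w hw
    have hO : (fun n => w n - y) =O[Filter.atTop] h := by
      refine Asymptotics.IsBigO.of_bound K (Filter.Eventually.of_forall fun n => ?_)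
      rw [Real.norm_of_nonneg (hpos n).le]
      exact hw n
    have hty : Filter.Tendsto w Filter.atTop (nhds y) :=
      tendsto_sub_nhds_zero_iff.1 (hO.trans_tendsto hlim)
    exact (hφ.isLittleO.comp_tendsto hty).trans_isBigO hO
  have h1 := ((hone w hw).sub (hone w' hw')).tendsto_inv_smul_nhds_zero
  have h2 : ∀ n, (h n)⁻¹ • (φ (w n) - φ (w' n)) = (h n)⁻¹ • (φ (w n) - φ y - T (w n - y) -
      (φ (w' n) - φ y - T (w' n - y))) + T v := by
    intro n
    have h3 : T (w n - y) - T (w' n - y) = h n • T v := by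
      rw [← map_sub, sub_sub_sub_cancel_right, hv, map_smul]
    have h4 : φ (w n) - φ y - T (w n - y) - (φ (w' n) - φ y - T (w' n - y)) =
        (φ (w n) - φ (w' n)) - h n • T v := by rw [← h3]; abel
    rw [h4, smul_sub _ _ (h n • T v), smul_smul, inv_mul_cancel₀ (hpos n).ne', one_smul,
      sub_add_cancel]
  simpa only [h2, zero_add] using h1.add_const (T v)

theorem abs_kuhnVertex_sub_le (y : RVec N) (j i : Fin N) : |(kuhnVertex y j i : ℝ) - y i| ≤ 1 := by
  have f1 := Int.floor_le (y j)
  have f2 := Int.lt_floor_add_one (y j)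
  have f3 := Int.floor_le (y i - y j)
  have f4 := Int.lt_floor_add_one (y i - y j)
  rw [kuhnVertex, abs_le]
  push_cast
  constructor <;> linarith

/-- The `j`-th slope is a difference quotient of `φ` along an edge `h eⱼ` whose ends are at distance
`O(h)` from `y`. Differentiability at `y` alone therefore suffices, although neither end is `y`. -/
theorem tendsto_kuhnSlope {φ : RVec N → RVec m} {y : RVec N} (hφ : DifferentiableAt ℝ φ y)
    {h : ℕ → ℝ} (hpos : ∀ n, 0 < h n) (hlim : Filter.Tendsto h Filter.atTop (nhds 0))
    (j : Fin N) :
    Filter.Tendsto (fun n => (h n)⁻¹ • kuhnSlope (latticeSample φ (h n)) ((h n)⁻¹ • y) j)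
      Filter.atTop (nhds (fderiv ℝ φ y (EuclideanSpace.single j 1))) := by
  have hy : ∀ n i, y i = h n * ((h n)⁻¹ • y) i := fun n i => by
    simp only [PiLp.smul_apply, smul_eq_mul]; rw [mul_inv_cancel_left₀ (hpos n).ne']
  have hdiff : ∀ n, (WithLp.toLp 2 fun i => h n * (kuhnVertex ((h n)⁻¹ • y) j i : ℝ) : RVec N) -
      (WithLp.toLp 2 fun i => h n * ((kuhnVertex ((h n)⁻¹ • y) j - Pi.single j 1 : Fin N → ℤ) i : ℝ)
        : RVec N) = h n • EuclideanSpace.single j (1 : ℝ) := by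
    intro n
    ext i
    by_cases hij : i = j
    · subst hij; simp; ring
    · simp [hij]
  have hw : ∀ n, ‖(WithLp.toLp 2 fun i => h n * (kuhnVertex ((h n)⁻¹ • y) j i : ℝ) : RVec N) - y‖ ≤
      N * h n := by
    intro n
    refine (norm_le_sum_abs _).trans ((Finset.sum_le_sum (g := fun _ => h n) fun i _ => ?_).trans
      (by simp))
    simp only [PiLp.sub_apply]
    rw [hy n i, ← mul_sub, abs_mul, abs_of_pos (hpos n)]
    exact mul_le_of_le_one_right (hpos n).le (abs_kuhnVertex_sub_le _ _ _)
  -- The upper vertex is within `N * h` of `y`, and the lower one is an edge of length `h` further: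
  -- hence `N + 1`.
  refine hφ.hasFDerivAt.tendsto_inv_smul_sub hpos hlim (K := N + 1)
    (w := fun n => WithLp.toLp 2 fun i => h n * (kuhnVertex ((h n)⁻¹ • y) j i : ℝ))
    (w' := fun n => WithLp.toLp 2 fun i =>
      h n * ((kuhnVertex ((h n)⁻¹ • y) j - Pi.single j 1 : Fin N → ℤ) i : ℝ)) ?_ ?_ hdiff
  · intro n
    exact (hw n).trans (mul_le_mul_of_nonneg_right (by linarith) (hpos n).le)
  · intro n
    rw [← sub_sub_sub_cancel_left (c := (WithLp.toLp 2 fun i =>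
      h n * (kuhnVertex ((h n)⁻¹ • y) j i : ℝ) : RVec N)), hdiff]
    refine (norm_sub_le _ _).trans ?_
    rw [norm_smul, Real.norm_of_nonneg (hpos n).le]
    simp only [PiLp.norm_single, norm_one]
    linarith [hw n]

/-! ### From piecewise affine to Lipschitz maps -/

namespace IsPiecewiseAffineQuasiconvex

variable {g : RMat m N → ℝ≥0∞}

/-- For finite functions, the quasiconvexity inequality extends from piecewise affine maps to all
Lipschitz maps. -/
theorem volume_mul_le (hg : IsPiecewiseAffineQuasiconvex g) (hfin : ∀ ξ, g ξ ≠ ∞)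
    {ξ : RMat m N} {D : Set (RVec N)} (hD : IsOpen D) (hDb : Bornology.IsBounded D)
    (hfr : volume (frontier D) = 0) {φ : RVec N → RVec m} {L : NNReal} (hφ : LipschitzWith L φ)
    (h0 : ∀ y ∉ D, φ y = 0) : volume D * g ξ ≤ ∫⁻ y in D, g (ξ + jac φ y) := by
  have hgc := hg.continuous hfin
  obtain ⟨C, hC⟩ : ∃ C, ∀ y, ‖φ y‖ ≤ C := by
    obtain ⟨C, hC⟩ := (hDb.isCompact_closure.image hφ.continuous).isBounded.exists_norm_le
    refine ⟨max C 0, fun y => ?_⟩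
    by_cases hy : y ∈ D
    · exact (hC _ ⟨y, subset_closure hy, rfl⟩).trans (le_max_left _ _)
    · rw [h0 y hy, norm_zero]; exact le_max_right _ _
  -- Interpolation enlarges the support by at most `N * h ≤ N`, so one cube serves for all mesh
  -- sizes `h n ≤ 1`.
  obtain ⟨c, r, hr, hQ⟩ := exists_subset_cube (hDb.cthickening (δ := N))
  have hDQ : D ⊆ cube c r := (Metric.self_subset_cthickening D).trans hQ
  refine volume_mul_le_of_cube (hfin ξ) hD hfr h0 hDQ ?_
  let h : ℕ → ℝ := fun n => 1 / ((n : ℝ) + 1)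
  have hpos : ∀ n, 0 < h n := fun n => by positivity
  have hle : ∀ n, h n ≤ 1 := fun n => by
    rw [div_le_one (by positivity)]; linarith [(Nat.cast_nonneg n : (0 : ℝ) ≤ n)]
  have hlim : Filter.Tendsto h Filter.atTop (nhds 0) := tendsto_one_div_add_atTop_nhds_zero_nat
  have hLip : ∀ n, LipschitzWith (L * N) (kuhnInterp φ (h n)) := fun n =>
    lipschitzWith_kuhnInterp hφ hC (hpos n)
  have haff := fun n => ae_kuhnInterp_eventually_affine (N := N) hC (hpos n)
  have hineq : ∀ n, volume (cube c r) * g ξ ≤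
      ∫⁻ y in cube c r, g (ξ + jac (kuhnInterp φ (h n)) y) := by
    intro n
    have hfr := finite_range_latticeSample hDb h0 (hpos n)
    have hW := ((hfr.prod hfr).image fun q : RVec m × RVec m => (h n)⁻¹ • (q.1 - q.2))
    refine hg ξ _ (isOpen_cube c r) (isBounded_cube c hr.le) ((convex_cube c r).addHaar_frontier _)
      _ _ (hLip n) (fun y hy => ?_) _ ((Set.Finite.pi' fun _ : Fin N => hW).image ofColumns)
      (ae_restrict_of_ae ?_)
    · refine kuhnInterp_eq_zero h0 (hpos n) fun hy' => hy (hQ (Metric.cthickening_mono ?_ D hy'))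
      exact mul_le_of_le_one_right (Nat.cast_nonneg N) (hle n)
    · filter_upwards [haff n] with y hy
      refine ⟨_, mem_image_of_mem _ fun j => ?_, hy⟩
      exact ⟨(_, _), ⟨mem_range_self _, mem_range_self _⟩, rfl⟩
  -- The interpolants are `L * N`-Lipschitz whatever the mesh. Local boundedness of `g` thus
  -- supplies a constant dominating function on the cube.
  obtain ⟨M, hMt, hM⟩ := hg.exists_bound hfin (∑ p : Fin m × Fin N, |ξ p.1 p.2| + L * N)
  have hbound : ∀ n y, g (ξ + jac (kuhnInterp φ (h n)) y) ≤ M := by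
    intro n y
    refine hM _ fun i j => (abs_add_le _ _).trans (add_le_add ?_ ?_)
    · exact Finset.single_le_sum (f := fun p : Fin m × Fin N => |ξ p.1 p.2|)
        (fun _ _ => abs_nonneg _) (Finset.mem_univ (i, j))
    · simpa using abs_jac_le (hLip n) y i j
  have hjac : ∀ᵐ y : RVec N, Filter.Tendsto (fun n => jac (kuhnInterp φ (h n)) y) Filter.atTop
      (nhds (jac φ y)) := by
    filter_upwards [ae_all_iff.2 haff, hφ.ae_differentiableAt (μ := volume)] with y hy hyd
    have h1 : ∀ n, jac (kuhnInterp φ (h n)) y = linMat (ofColumns fun j =>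
        (h n)⁻¹ • kuhnSlope (latticeSample φ (h n)) ((h n)⁻¹ • y) j) := fun n =>
      jac_eq_linMat (hasFDerivAt_of_eventually_affine (hy n))
    simp only [h1]
    refine tendsto_pi_nhds.2 fun i => tendsto_pi_nhds.2 fun j => ?_
    have h2 := ((continuous_coord i).tendsto _).comp (tendsto_kuhnSlope hyd hpos hlim j)
    exact h2.congr fun n => (linMat_ofColumns _ i j).symm
  have hconv := tendsto_lintegral_of_dominated_convergence (μ := volume.restrict (cube c r))
    (F := fun n y => g (ξ + jac (kuhnInterp φ (h n)) y)) (f := fun y => g (ξ + jac φ y))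
    (fun _ => M)
    (fun n => hgc.measurable.comp ((measurable_jac _).const_add ξ))
    (fun n => Filter.Eventually.of_forall (hbound n))
    (by
      rw [setLIntegral_const]
      exact ENNReal.mul_ne_top hMt (volume_cube_ne_top c r))
    (ae_restrict_of_ae (by
      filter_upwards [hjac] with y hy
      exact (hgc.tendsto _).comp (hy.const_add ξ)))
  exact ge_of_tendsto' hconv hineq

theorem isQuasiconvex (hg : IsPiecewiseAffineQuasiconvex g) (hfin : ∀ ξ, g ξ ≠ ∞) :
    IsQuasiconvex g where
  measurable := (hg.continuous hfin).measurable
  le_average ξ D hD hne hDb hfr φ G hφ := by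
    obtain ⟨u, L, hL, h0, hj⟩ := hφ.exists_lipschitzWith hD
    have h1 := hg.volume_mul_le hfin (ξ := ξ) hD hDb hfr hL h0
    have h2 : ∫⁻ y in D, g (ξ + jac u y) = ∫⁻ y in D, g (ξ + G y) := by
      refine lintegral_congr_ae ?_
      filter_upwards [hj] with y hy
      rw [hy]
    rw [h2, mul_comm, ← ENNReal.le_div_iff_mul_le (Or.inl (hD.measure_pos volume hne).ne')
      (Or.inl hDb.measure_lt_top.ne), div_eq_mul_inv, mul_comm] at h1
    exact h1

end IsPiecewiseAffineQuasiconvex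

/-! ### `𝒵f(x,·)` as the greatest quasiconvex minorant -/

theorem volume_unitCube : volume (unitCube N) = 1 := by
  rw [unitCube_eq_cube, volume_cube, ENNReal.ofReal_one, one_pow]

theorem ZEnvelope_le (f : RVec N → RMat m N → ℝ≥0∞) (x : RVec N) : ZEnvelope f x ≤ f x := by
  intro ξ
  have h := ZEnvelope_le_lintegral (f := f) (x := x) (ξ := ξ)
    (LipschitzWith.const (α := RVec N) (0 : RVec m)) fun _ _ => rfl
  have hj : ∀ y : RVec N, jac (fun _ : RVec N => (0 : RVec m)) y = 0 := fun y =>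
    jac_eq_zero_of_eventuallyEq_const (Filter.Eventually.of_forall fun _ => rfl)
  simpa [hj, volume_unitCube] using h

theorem IsQuasiconvex.le_ZEnvelope {f : RVec N → RMat m N → ℝ≥0∞} {x : RVec N}
    {q : RMat m N → ℝ≥0∞} (hq : IsQuasiconvex q) (hle : q ≤ f x) : q ≤ ZEnvelope f x := by
  intro ξ
  refine le_iInf fun φ => le_iInf fun G => le_iInf fun hφ => ?_
  have hne : (unitCube N).Nonempty :=
    ⟨WithLp.toLp 2 fun _ => 1 / 2, fun i => by constructor <;> norm_num⟩
  have h := hq.le_average ξ (unitCube N) (unitCube_eq_cube (N := N) ▸ isOpen_cube _ _) hne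
    (unitCube_eq_cube (N := N) ▸ isBounded_cube _ zero_le_one)
    (unitCube_eq_cube (N := N) ▸ (convex_cube _ _).addHaar_frontier _) φ G hφ
  rw [volume_unitCube, inv_one, one_mul] at h
  exact h.trans (lintegral_mono fun y => hle _)

theorem isGreatest_ZEnvelope {f : RVec N → RMat m N → ℝ≥0∞} {x : RVec N}
    (hfin : ∀ ξ, ZEnvelope f x ξ < ∞) :
    IsGreatest (quasiconvexMinorants (f x)) (ZEnvelope f x) :=
  ⟨⟨(isPiecewiseAffineQuasiconvex_ZEnvelope hfin).isQuasiconvex fun ξ => (hfin ξ).ne,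
    ZEnvelope_le f x⟩, fun _ hq => hq.1.le_ZEnvelope hq.2⟩

theorem mainTheorem6 {m N : ℕ} (hm : 1 ≤ m) (hN : 1 ≤ N) (f : RVec N → RMat m N → ℝ≥0∞)
    (hf : IsNormalIntegrand f) (hfin : ∀ x ξ, ZEnvelope f x ξ < ∞) :
    (∀ x, IsGreatest (quasiconvexMinorants (f x)) (quasiconvexEnvelope f x)) ∧
      quasiconvexEnvelope f = ZEnvelope f ∧
      ∀ x, IsQuasiconvex (ZEnvelope f x) := by
  have hZ : ∀ x, IsGreatest (quasiconvexMinorants (f x)) (ZEnvelope f x) := fun x =>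
    isGreatest_ZEnvelope (hfin x)
  have hQ : ∀ x, quasiconvexEnvelope f x = ZEnvelope f x := fun x =>
    quasiconvexEnvelope_eq_of_isGreatest (hZ x)
  exact ⟨fun x => (hQ x).symm ▸ hZ x, funext hQ, fun x => (hZ x).1.1⟩
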